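/- Compositions are written from left to right, and a groupoid is a (small) category in which every arrow is invertible. **Bitorsors.** A *bi-action* consists of a span of sets $A\xleftarrow{\alpha}X\xrightarrow{\beta}B$, a groupoid $G$ with object set $A$ acting on $X\to A$ from the left ($g\cdot x$ is defined when $\alpha(x)$ is the codomain of $g$, and then $\alpha(g\cdot x)$ is the domain of $g$), and a groupoid $H$ with object set $B$ acting on $X\to B$ from the right, both actions being unitary and associative and commuting with each other (in particular $\beta(g\cdot x)=\beta(x)$ and $\alpha(x\cdot h)=\alpha(x)$). A morphism consists of functors $G\to G'$, $H\to H'$ and a map $X\to X'$ compatible with the structural maps and the actions. A *bitorsor* is a bi-action such that $X$ is inhabited, $\alpha$ and $\beta$ are surjective, for $x,y\in X$ there is at most one $g$ with $g\cdot x=y$ and at most one $h$ with $x\cdot h=y$, and $\beta(x)=\beta(y)$ if and only if $y=g\cdot x$ for some $g$, and $\alpha(x)=\alpha(y)$ if and only if $y=x\cdot h$ for some $h$. Bitorsors form a full subcategory of the category of bi-actions. **Pregroupoids.** A *pregroupoid* on $A,B$ is an inhabited set $X$ with surjections $\alpha:X\to A$, $\beta:X\to B$ and a partial ternary operation $yx^{-1}z$,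 defined exactly when $\beta(x)=\beta(y)$ and $\alpha(x)=\alpha(z)$, such that $\alpha(yx^{-1}z)=\alpha(y)$, $\beta(yx^{-1}z)=\beta(z)$ and, whenever the expressions are defined, $$xx^{-1}z=z,\qquad yx^{-1}x=y,\qquad vy^{-1}(yx^{-1}z)=vx^{-1}z,\qquad (yx^{-1}z)z^{-1}w=yx^{-1}w .$$ A morphism consists of maps $A\to A'$, $B\to B'$, $X\to X'$ commuting with the structural maps and preserving the ternary operation. A bitorsor $A\leftarrow X\to B$ gives a pregroupoid on the same span by $yx^{-1}z:=g\cdot z$, where $g$ is the unique arrow with $g\cdot x=y$. **Enveloping groupoid.** The enveloping groupoid $X^+$ of a pregroupoid $X$ has object set the disjoint sum $A+B$. Its arrows from $A$ to $A$ are the fractions $yx^{-1}:\alpha(y)\to\alpha(x)$, i.e. classes of pairs $(y,x)$ with $\beta(x)=\beta(y)$ under $(y,x)\sim(u,z)\Leftrightarrow u=yx^{-1}z$; its arrows from $B$ to $B$ are the fractions $x^{-1}z:\beta(x)\to\beta(z)$, i.e. classes of pairs $(x,z)$ with $\alpha(x)=\alpha(z)$ under $(x,z)\sim(y,u)\Leftrightarrow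 u=yx^{-1}z$; its arrows from $A$ to $B$ are the elements $x:\alpha(x)\to\beta(x)$ of $X$, and its arrows from $B$ to $A$ are formal inverses $x^{-1}:\beta(x)\to\alpha(x)$ of elements of $X$. Composition is determined by $yx^{-1}\circ z=yx^{-1}z$, $y\circ x^{-1}z=yx^{-1}z$, $y\circ x^{-1}=yx^{-1}$, $x^{-1}\circ z=x^{-1}z$, $uv^{-1}\circ yx^{-1}=(uv^{-1}y)x^{-1}$, $x^{-1}z\circ u^{-1}v=x^{-1}(zu^{-1}v)$, $z^{-1}\circ xy^{-1}=(yx^{-1}z)^{-1}$ and $z^{-1}x\circ y^{-1}=(yx^{-1}z)^{-1}$. **Fibrations.** Let $\mathbf I$ be the groupoid with two objects $a_0,b_0$ and, besides the identities, exactly one arrow $a_0\to b_0$ and its inverse. A *fibration-in-groupoids* over $\mathbf I$ is a fibred category $\gamma:\mathbf X\to\mathbf I$ ($\mathbf X$ small) whose fibres are groupoids; $\mathbf X$ is then itself a groupoid. Morphisms are functors $\mathbf X\to\mathbf X'$ commuting strictly with the projections to $\mathbf I$. For such $\mathbf X$ let $A$ and $B$ be the sets of objects over $a_0$ and $b_0$,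 and let $\mathbf X(A,B)$ be the set of arrows with domain in $A$ and codomain in $B$, with its maps to $A$ and $B$ and the actions of the full subgroupoids $\mathbf X(A,A)$ and $\mathbf X(B,B)$ by pre- and postcomposition. **Theorem 4.1.** The category of bitorsors is equivalent to the category of fibrations-in-groupoids over $\mathbf I$ with inhabited total category. More precisely, $\mathbf X\mapsto\mathbf X(A,B)$ is a functor from the latter category to the category of bitorsors, $X\mapsto X^+$ (the enveloping groupoid of the pregroupoid of the bitorsor $X$, with the functor $X^+\to\mathbf I$ sending $A$ to $a_0$ and $B$ to $b_0$) is a functor in the opposite direction, and these two functors are mutually quasi-inverse equivalences. Hence the category of pregroupoids is also equivalent to the category of fibrations-in-groupoids over $\mathbf I$ with inhabited total category, through the mutually quasi-inverse functors sending $X$ to $X^+\to\mathbf I$ and sending $\mathbf X$ to the pregroupoid of the bitorsor $\mathbf X(A,B)$. -/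

import Mathlib

open CategoryTheory

universe u

namespace Kock

/-! ### Pregroupoids -/

/-- A pregroupoid on `A`, `B`: an inhabited set `X` with surjections `α : X → A`, `β : X → B` and
a partial ternary operation `op y x z`, thought of as `y x⁻¹ z`, which is defined exactly when
`β x = β y` and `α x = α z`. -/
structure Pregroupoid where
  A : Type u
  B : Type u
  X : Type u
  inhabited : Nonempty X
  α : X → A
  β : X → B
  α_surjective : Function.Surjective α
  β_surjective : Function.Surjective β
  op (y x z : X) (h : β x = β y) (h' : α x = α z) : X
  α_op (y x z : X) (h : β x = β y) (h' : α x = α z) : α (op y x z h h') = α y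
  β_op (y x z : X) (h : β x = β y) (h' : α x = α z) : β (op y x z h h') = β z
  /-- `x x⁻¹ z = z` -/
  unit_left (x z : X) (h' : α x = α z) : op x x z rfl h' = z
  /-- `y x⁻¹ x = y` -/
  unit_right (y x : X) (h : β x = β y) : op y x x h rfl = y
  /-- `v y⁻¹ (y x⁻¹ z) = v x⁻¹ z` -/
  concat_left (v y x z : X) (h : β x = β y) (h' : α x = α z) (hv : β y = β v) :
    op v y (op y x z h h') hv (α_op y x z h h').symm = op v x z (h.trans hv) h'
  /-- `(y x⁻¹ z) z⁻¹ w = y x⁻¹ w` -/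
  concat_right (y x z w : X) (h : β x = β y) (h' : α x = α z) (hw : α z = α w) :
    op (op y x z h h') z w (β_op y x z h h').symm hw = op y x w h (h'.trans hw)

namespace Pregroupoid

/-- A morphism of pregroupoids: three maps commuting with the structural maps and preserving
the ternary operation. -/
@[ext]
structure Hom (P Q : Pregroupoid.{u}) where
  mapA : P.A → Q.A
  mapB : P.B → Q.B
  map : P.X → Q.X
  α_map (x : P.X) : Q.α (map x) = mapA (P.α x)
  β_map (x : P.X) : Q.β (map x) = mapB (P.β x)
  map_op (y x z : P.X) (h : P.β x = P.β y) (h' : P.α x = P.α z) :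
    map (P.op y x z h h') =
      Q.op (map y) (map x) (map z) (by rw [β_map, β_map, h]) (by rw [α_map, α_map, h'])

instance : Category Pregroupoid.{u} where
  Hom := Hom
  id P :=
    { mapA := id
      mapB := id
      map := id
      α_map := fun _ => rfl
      β_map := fun _ => rfl
      map_op := fun _ _ _ _ _ => rfl }
  comp f g :=
    { mapA := g.mapA ∘ f.mapA
      mapB := g.mapB ∘ f.mapB
      map := g.map ∘ f.map
      α_map := fun x => by simp [f.α_map, g.α_map]
      β_map := fun x => by simp [f.β_map, g.β_map]
      map_op := fun y x z h h' => by simp [f.map_op, g.map_op] }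

end Pregroupoid

/-! ### Bi-actions and bitorsors -/

/-- A bi-action: a span `A ← X → B`, a groupoid with object set `A` acting on `X → A` from the
left, and a groupoid with object set `B` acting on `X → B` from the right, such that the two
actions commute. Composition is written from left to right, so `g : a ⟶ a'` can act on the left
on an `x` over `a'`, the result lying over `a`. -/
structure BiAction where
  A : Type u
  B : Type u
  X : Type u
  [groupoidA : Groupoid.{u} A]
  [groupoidB : Groupoid.{u} B]
  α : X → A
  β : X → B
  /-- the left action `g · x` -/
  lact {a a' : A} (g : a ⟶ a') (x : X) (hx : α x = a') : X
  α_lact {a a' : A} (g : a ⟶ a') (x : X) (hx : α x = a') : α (lact g x hx) = a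
  lact_id (x : X) {a : A} (hx : α x = a) : lact (𝟙 a) x hx = x
  lact_comp {a a' a'' : A} (f : a ⟶ a') (g : a' ⟶ a'') (x : X) (hx : α x = a'') :
    lact (f ≫ g) x hx = lact f (lact g x hx) (α_lact g x hx)
  /-- the right action `x · k` -/
  ract {b b' : B} (x : X) (k : b ⟶ b') (hx : β x = b) : X
  β_ract {b b' : B} (x : X) (k : b ⟶ b') (hx : β x = b) : β (ract x k hx) = b'
  ract_id (x : X) {b : B} (hx : β x = b) : ract x (𝟙 b) hx = x
  ract_comp {b b' b'' : B} (x : X) (k : b ⟶ b') (l : b' ⟶ b'') (hx : β x = b) :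
    ract x (k ≫ l) hx = ract (ract x k hx) l (β_ract x k hx)
  β_lact {a a' : A} (g : a ⟶ a') (x : X) (hx : α x = a') : β (lact g x hx) = β x
  α_ract {b b' : B} (x : X) (k : b ⟶ b') (hx : β x = b) : α (ract x k hx) = α x
  lact_ract {a a' : A} {b b' : B} (g : a ⟶ a') (x : X) (k : b ⟶ b') (hx : α x = a')
    (hx' : β x = b) :
    lact g (ract x k hx') ((α_ract x k hx').trans hx) =
      ract (lact g x hx) k ((β_lact g x hx).trans hx')

namespace BiAction

attribute [instance] BiAction.groupoidA BiAction.groupoidB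

/-- A morphism of bi-actions: a functor between the left groupoids, a functor between the right
groupoids, and a map, compatible with the structural maps and with the actions. -/
@[ext]
structure Hom (V W : BiAction.{u}) where
  functorA : V.A ⥤ W.A
  functorB : V.B ⥤ W.B
  map : V.X → W.X
  α_map (x : V.X) : W.α (map x) = functorA.obj (V.α x)
  β_map (x : V.X) : W.β (map x) = functorB.obj (V.β x)
  map_lact {a a' : V.A} (g : a ⟶ a') (x : V.X) (hx : V.α x = a') :
    map (V.lact g x hx) = W.lact (functorA.map g) (map x) (by rw [α_map, hx])
  map_ract {b b' : V.B} (x : V.X) (k : b ⟶ b') (hx : V.β x = b) :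
    map (V.ract x k hx) = W.ract (map x) (functorB.map k) (by rw [β_map, hx])

instance : Category BiAction.{u} where
  Hom := Hom
  id V :=
    { functorA := 𝟭 V.A
      functorB := 𝟭 V.B
      map := id
      α_map := fun _ => rfl
      β_map := fun _ => rfl
      map_lact := fun _ _ _ => rfl
      map_ract := fun _ _ _ => rfl }
  comp f g :=
    { functorA := f.functorA ⋙ g.functorA
      functorB := f.functorB ⋙ g.functorB
      map := g.map ∘ f.map
      α_map := fun x => by simp [f.α_map, g.α_map]
      β_map := fun x => by simp [f.β_map, g.β_map]
      map_lact := fun k x hx => by simp [f.map_lact, g.map_lact]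
      map_ract := fun x k hx => by simp [f.map_ract, g.map_ract] }

/-- A bi-action is a bitorsor if `X` is inhabited, both structural maps are surjective, both
action groupoids are equivalence relations (there is at most one arrow `g` with `g · x = y`,
respectively with `x · k = y`), `β : X → B` is a quotient map for the equivalence relation
given by the left action, and `α : X → A` is a quotient map for the one given by the right
action. -/
structure IsBitorsor (W : BiAction.{u}) : Prop where
  inhabited : Nonempty W.X
  α_surjective : Function.Surjective W.α
  β_surjective : Function.Surjective W.β
  lact_free {a a' : W.A} (g g' : a ⟶ a') (x : W.X) (hx : W.α x = a') :
    W.lact g x hx = W.lact g' x hx → g = g'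
  ract_free {b b' : W.B} (k k' : b ⟶ b') (x : W.X) (hx : W.β x = b) :
    W.ract x k hx = W.ract x k' hx → k = k'
  β_eq_iff (x y : W.X) :
    W.β x = W.β y ↔ ∃ (a a' : W.A) (g : a ⟶ a') (hx : W.α x = a'), W.lact g x hx = y
  α_eq_iff (x y : W.X) :
    W.α x = W.α y ↔ ∃ (b b' : W.B) (k : b ⟶ b') (hx : W.β x = b), W.ract x k hx = y

end BiAction

/-- The category of bitorsors, a full subcategory of the category of bi-actions. -/
abbrev Bitorsor : Type (u + 1) := ObjectProperty.FullSubcategory BiAction.IsBitorsor.{u}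

/-! ### From bitorsors to pregroupoids -/

namespace BiAction

variable {V W : BiAction.{u}}

lemma IsBitorsor.existsUnique_lact (hW : W.IsBitorsor) (x y : W.X) (h : W.β x = W.β y) :
    ∃! g : W.α y ⟶ W.α x, W.lact g x rfl = y := by
  obtain ⟨a, a', g, rfl, hy⟩ := (hW.β_eq_iff x y).1 h
  obtain rfl : W.α y = a := by rw [← hy, W.α_lact]
  exact ⟨g, hy, fun g' hg' => hW.lact_free _ _ x rfl (hg'.trans hy.symm)⟩

/-- The unique arrow `y x⁻¹` with `y x⁻¹ · x = y`. -/
noncomputable def IsBitorsor.fraction (hW : W.IsBitorsor) (x y : W.X) (h : W.β x = W.β y) :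
    W.α y ⟶ W.α x :=
  (hW.existsUnique_lact x y h).choose

lemma IsBitorsor.fraction_lact (hW : W.IsBitorsor) (x y : W.X) (h : W.β x = W.β y) :
    W.lact (hW.fraction x y h) x rfl = y :=
  (hW.existsUnique_lact x y h).choose_spec.1

lemma IsBitorsor.fraction_lact_eq (hW : W.IsBitorsor) (x y : W.X) (h : W.β x = W.β y)
    {a a' : W.A} (g : a ⟶ a') (hx : W.α x = a') (hg : W.lact g x hx = y)
    (z : W.X) (hz : W.α x = W.α z) :
    W.lact (hW.fraction x y h) z hz.symm = W.lact g z (hz.symm.trans hx) := by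
  subst hx
  obtain rfl : W.α y = a := by rw [← hg, W.α_lact]
  rw [hW.lact_free _ g x rfl ((hW.fraction_lact x y h).trans hg.symm)]

/-- The pregroupoid of a bitorsor, with `y x⁻¹ z := (y x⁻¹) · z`. -/
noncomputable def IsBitorsor.toPregroupoid (hW : W.IsBitorsor) : Pregroupoid.{u} where
  A := W.A
  B := W.B
  X := W.X
  inhabited := hW.inhabited
  α := W.α
  β := W.β
  α_surjective := hW.α_surjective
  β_surjective := hW.β_surjective
  op y x z h h' := W.lact (hW.fraction x y h) z h'.symm
  α_op y x z h h' := W.α_lact _ _ _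
  β_op y x z h h' := W.β_lact _ _ _
  unit_left x z h' := by
    rw [hW.fraction_lact_eq x x rfl (𝟙 _) rfl (W.lact_id _ _) z h', W.lact_id]
  unit_right y x h := hW.fraction_lact x y h
  concat_left v y x z h h' hv := by
    rw [← W.lact_comp]
    symm
    refine hW.fraction_lact_eq x v (h.trans hv) _ rfl ?_ z h'
    rw [W.lact_comp]
    simp only [hW.fraction_lact]
  concat_right y x z w h h' hw := by
    rw [hW.fraction_lact_eq z _ _ (hW.fraction x y h) h'.symm rfl w hw]

end BiAction

/-- The functor from bitorsors to pregroupoids, which remembers the span and the ternary operation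
`y x⁻¹ z := (y x⁻¹) · z`, where `y x⁻¹` is the unique arrow with `y x⁻¹ · x = y`. -/
noncomputable def Bitorsor.toPregroupoid : Bitorsor.{u} ⥤ Pregroupoid.{u} where
  obj W := W.property.toPregroupoid
  map {V W} f :=
    { mapA := f.hom.functorA.obj
      mapB := f.hom.functorB.obj
      map := f.hom.map
      α_map := f.hom.α_map
      β_map := f.hom.β_map
      map_op := fun y x z h h' => by
        refine (f.hom.map_lact _ _ _).trans ?_
        symm
        apply W.property.fraction_lact_eq (f.hom.map x) (f.hom.map y) _ _ (f.hom.α_map x)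
        · rw [← f.hom.map_lact _ x rfl, V.property.fraction_lact x y h]
        · exact (f.hom.α_map x).trans
            ((congrArg f.hom.functorA.obj h').trans (f.hom.α_map z).symm) }
  map_id _ := rfl
  map_comp _ _ := rfl

/-! ### The enveloping groupoid of a pregroupoid -/

namespace Pregroupoid

variable (P : Pregroupoid.{u})

/-- Pairs `(y, x)` with `β y = β x`, where `α y = a` and `α x = a'`. -/
structure HPair (a a' : P.A) : Type u where
  y : P.X
  x : P.X
  h : P.β x = P.β y
  hy : P.α y = a
  hx : P.α x = a'

/-- Pairs `(x, z)` with `α x = α z`, where `β x = b` and `β z = b'`. -/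
structure VPair (b b' : P.B) : Type u where
  x : P.X
  z : P.X
  h : P.α x = P.α z
  hx : P.β x = b
  hz : P.β z = b'

variable {P}

lemma op_congr {y x z y' x' z' : P.X} {h h'} (hy : y = y') (hx : x = x') (hz : z = z') :
    P.op y x z h h' = P.op y' x' z' (by rw [← hx, ← hy, h]) (by rw [← hx, ← hz, h']) := by
  subst hy hx hz; rfl

/-- `x y⁻¹ (y x⁻¹ z) = z` -/
lemma op_cancel_left (y x z : P.X) (h : P.β x = P.β y) (h' : P.α x = P.α z) :
    P.op x y (P.op y x z h h') h.symm (P.α_op y x z h h').symm = z := by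
  rw [P.concat_left x y x z h h' h.symm, P.unit_left]

/-- `(y x⁻¹ z) z⁻¹ x = y` -/
lemma op_cancel_right (y x z : P.X) (h : P.β x = P.β y) (h' : P.α x = P.α z) :
    P.op (P.op y x z h h') z x (P.β_op y x z h h').symm h'.symm = y := by
  rw [P.concat_right y x z x h h' h'.symm, P.unit_right]

/-- `(1 2⁻¹ 3) 4⁻¹ 5 = 1 2⁻¹ (3 4⁻¹ 5)` -/
lemma op_assoc (x₁ x₂ x₃ x₄ x₅ : P.X) (h₁ : P.β x₂ = P.β x₁) (h₂ : P.α x₂ = P.α x₃)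
    (h₃ : P.β x₄ = P.β x₃) (h₄ : P.α x₄ = P.α x₅) :
    P.op (P.op x₁ x₂ x₃ h₁ h₂) x₄ x₅ (by rw [P.β_op, h₃]) h₄ =
      P.op x₁ x₂ (P.op x₃ x₄ x₅ h₃ h₄) h₁ (by rw [P.α_op, h₂]) := by
  rw [← P.concat_left (P.op x₁ x₂ x₃ h₁ h₂) x₃ x₄ x₅ h₃ h₄ (P.β_op x₁ x₂ x₃ h₁ h₂).symm,
    P.concat_right]

/-- `6 (3 4⁻¹ 5)⁻¹ 2 = 6 5⁻¹ (4 3⁻¹ 2)` -/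
lemma op_op_inv (x₂ x₃ x₄ x₅ x₆ : P.X) (h₁ : P.β x₄ = P.β x₃) (h₂ : P.α x₄ = P.α x₅)
    (h₃ : P.β x₅ = P.β x₆) (h₄ : P.α x₃ = P.α x₂) :
    P.op x₆ (P.op x₃ x₄ x₅ h₁ h₂) x₂ (by rw [P.β_op, h₃]) (by rw [P.α_op, h₄]) =
      P.op x₆ x₅ (P.op x₄ x₃ x₂ h₁.symm h₄) h₃ (by rw [P.α_op, h₂]) := by
  rw [← P.concat_left x₆ x₅ (P.op x₃ x₄ x₅ h₁ h₂) x₂ (P.β_op _ _ _ _ _)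
    ((P.α_op _ _ _ _ _).trans h₄) h₃]
  apply op_congr rfl rfl
  rw [← P.concat_right x₅ (P.op x₃ x₄ x₅ h₁ h₂) x₃ x₂ (P.β_op _ _ _ _ _) (P.α_op _ _ _ _ _) h₄]
  apply op_congr _ rfl rfl
  have e := op_cancel_right x₃ x₄ x₅ h₁ h₂
  have e' := op_cancel_left (P.op x₃ x₄ x₅ h₁ h₂) x₅ x₄ (P.β_op _ _ _ _ _).symm h₂.symm
  exact (op_congr rfl rfl e.symm).trans e'

lemma op_assoc' (x₁ x₂ x₃ x₄ x₅ : P.X) (h₁ : P.β x₂ = P.β x₁) (h₂ : P.α x₂ = P.α x₃)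
    (h₃ : P.β x₄ = P.β (P.op x₁ x₂ x₃ h₁ h₂)) (h₄ : P.α x₄ = P.α x₅) :
    P.op (P.op x₁ x₂ x₃ h₁ h₂) x₄ x₅ h₃ h₄ =
      P.op x₁ x₂ (P.op x₃ x₄ x₅ (by rw [h₃, P.β_op]) h₄) h₁ (by rw [P.α_op, h₂]) :=
  op_assoc _ _ _ _ _ _ _ _ _

lemma op_op_inv' (x₂ x₃ x₄ x₅ x₆ : P.X) (h₁ : P.β x₄ = P.β x₃) (h₂ : P.α x₄ = P.α x₅)
    (h₃ : P.β (P.op x₃ x₄ x₅ h₁ h₂) = P.β x₆) (h₄ : P.α (P.op x₃ x₄ x₅ h₁ h₂) = P.α x₂) :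
    P.op x₆ (P.op x₃ x₄ x₅ h₁ h₂) x₂ h₃ h₄ =
      P.op x₆ x₅ (P.op x₄ x₃ x₂ h₁.symm (by rw [← h₄, P.α_op])) (by rw [← h₃, P.β_op])
        (by rw [P.α_op, h₂]) :=
  op_op_inv _ _ _ _ _ _ _ _ _

variable (P)

/-- The relation `(y, x) ≅ (u, z)` iff `u = y x⁻¹ z`. -/
instance hSetoid (a a' : P.A) : Setoid (P.HPair a a') where
  r p q := q.y = P.op p.y p.x q.x p.h (p.hx.trans q.hx.symm)
  iseqv :=
    { refl := fun _ => (P.unit_right _ _ _).symm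
      symm := fun {p q} hpq =>
        ((op_congr hpq rfl rfl).trans
          (op_cancel_right p.y p.x q.x p.h (p.hx.trans q.hx.symm))).symm
      trans := fun {p q r} hpq hqr =>
        (hqr.trans (op_congr hpq rfl rfl)).trans
          (P.concat_right p.y p.x q.x r.x p.h (p.hx.trans q.hx.symm) (q.hx.trans r.hx.symm)) }

/-- The relation `(x, z) ≅ (y, u)` iff `u = y x⁻¹ z`. -/
instance vSetoid (b b' : P.B) : Setoid (P.VPair b b') where
  r p q := q.z = P.op q.x p.x p.z (p.hx.trans q.hx.symm) p.h
  iseqv :=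
    { refl := fun _ => (P.unit_left _ _ _).symm
      symm := fun {p q} hpq =>
        ((op_congr rfl rfl hpq).trans
          (op_cancel_left q.x p.x p.z (p.hx.trans q.hx.symm) p.h)).symm
      trans := fun {p q r} hpq hqr =>
        (hqr.trans (op_congr rfl rfl hpq)).trans
          (P.concat_left r.x q.x p.x p.z (p.hx.trans q.hx.symm) p.h (q.hx.trans r.hx.symm)) }

/-- The set of fractions `y x⁻¹`, i.e. of classes of pairs `(y, x)`, from `a` to `a'`. -/
def HFrac (a a' : P.A) : Type u := Quotient (P.hSetoid a a')

/-- The set of fractions `x⁻¹ z`, i.e. of classes of pairs `(x, z)`, from `b` to `b'`. -/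
def VFrac (b b' : P.B) : Type u := Quotient (P.vSetoid b b')

/-- The set of elements of `X` over `a` and `b`. -/
@[ext]
structure Elt (a : P.A) (b : P.B) : Type u where
  val : P.X
  hα : P.α val = a
  hβ : P.β val = b

variable {P}

/-- The fraction `y x⁻¹`. -/
def HFrac.mk {a a' : P.A} (y x : P.X) (h : P.β x = P.β y) (hy : P.α y = a) (hx : P.α x = a') :
    P.HFrac a a' :=
  Quotient.mk _ ⟨y, x, h, hy, hx⟩

/-- The fraction `x⁻¹ z`. -/
def VFrac.mk {b b' : P.B} (x z : P.X) (h : P.α x = P.α z) (hx : P.β x = b) (hz : P.β z = b') :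
    P.VFrac b b' :=
  Quotient.mk _ ⟨x, z, h, hx, hz⟩

lemma HFrac.ind {a a' : P.A} {motive : P.HFrac a a' → Prop}
    (mk : ∀ y x h hy hx, motive (HFrac.mk y x h hy hx)) (f : P.HFrac a a') : motive f :=
  Quotient.ind (fun _ => mk _ _ _ _ _) f

lemma VFrac.ind {b b' : P.B} {motive : P.VFrac b b' → Prop}
    (mk : ∀ x z h hx hz, motive (VFrac.mk x z h hx hz)) (f : P.VFrac b b') : motive f :=
  Quotient.ind (fun _ => mk _ _ _ _ _) f

lemma HFrac.sound {a a' : P.A} {y x u z : P.X} {h : P.β x = P.β y} {hy : P.α y = a}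
    {hx : P.α x = a'} {h₁ : P.β z = P.β u} {hu : P.α u = a} {hz : P.α z = a'}
    (e : u = P.op y x z h (hx.trans hz.symm)) :
    HFrac.mk y x h hy hx = HFrac.mk u z h₁ hu hz :=
  Quotient.sound e

lemma VFrac.sound {b b' : P.B} {x z y u : P.X} {h : P.α x = P.α z} {hx : P.β x = b}
    {hz : P.β z = b'} {h₁ : P.α y = P.α u} {hy : P.β y = b} {hu : P.β u = b'}
    (e : u = P.op y x z (hx.trans hy.symm) h) :
    VFrac.mk x z h hx hz = VFrac.mk y u h₁ hy hu :=
  Quotient.sound e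

/-- `1 2⁻¹ ∘ 3 4⁻¹ = (1 2⁻¹ 3) 4⁻¹` -/
def compAAA {a a' a'' : P.A} : P.HFrac a a' → P.HFrac a' a'' → P.HFrac a a'' :=
  Quotient.map₂
    (fun p q =>
      { y := P.op p.y p.x q.y p.h (p.hx.trans q.hy.symm)
        x := q.x
        h := by rw [P.β_op, q.h]
        hy := by rw [P.α_op, p.hy]
        hx := q.hx })
    (fun p p' hp q q' hq => by
      refine (op_congr hp rfl rfl).trans ?_
      refine (P.concat_right _ _ _ _ _ _ (p'.hx.trans q'.hy.symm)).trans ?_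
      refine (op_congr rfl rfl hq).trans ?_
      exact (op_assoc _ _ _ _ _ _ _ _ _).symm)

/-- `1 2⁻¹ ∘ 3 = 1 2⁻¹ 3` -/
def compAAB {a a' : P.A} {b : P.B} (f : P.HFrac a a') (z : P.Elt a' b) : P.Elt a b :=
  Quotient.lift
    (fun p : P.HPair a a' => (⟨P.op p.y p.x z.val p.h (p.hx.trans z.hα.symm),
      by rw [P.α_op, p.hy], by rw [P.β_op, z.hβ]⟩ : P.Elt a b))
    (fun p p' hp => Elt.ext (by
      refine ((op_congr hp rfl rfl).trans ?_).symm
      exact P.concat_right _ _ _ _ _ _ (p'.hx.trans z.hα.symm))) f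

/-- `1 ∘ 2⁻¹ = 1 2⁻¹` -/
def compABA {a a' : P.A} {b : P.B} (y : P.Elt a b) (x : P.Elt a' b) : P.HFrac a a' :=
  HFrac.mk y.val x.val (x.hβ.trans y.hβ.symm) y.hα x.hα

/-- `1 ∘ 2⁻¹ 3 = 1 2⁻¹ 3` -/
def compABB {a : P.A} {b b' : P.B} (y : P.Elt a b) (f : P.VFrac b b') : P.Elt a b' :=
  Quotient.lift
    (fun p : P.VPair b b' => (⟨P.op y.val p.x p.z (p.hx.trans y.hβ.symm) p.h,
      by rw [P.α_op, y.hα], by rw [P.β_op, p.hz]⟩ : P.Elt a b'))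
    (fun p p' hp => Elt.ext (by
      refine ((op_congr rfl rfl hp).trans ?_).symm
      exact P.concat_left _ _ _ _ _ _ (p'.hx.trans y.hβ.symm))) f

/-- `3⁻¹ ∘ 2 1⁻¹ = (1 2⁻¹ 3)⁻¹` -/
def compBAA {a a' : P.A} {b : P.B} (z : P.Elt a b) (f : P.HFrac a a') : P.Elt a' b :=
  Quotient.lift
    (fun p : P.HPair a a' => (⟨P.op p.x p.y z.val p.h.symm (p.hy.trans z.hα.symm),
      by rw [P.α_op, p.hx], by rw [P.β_op, z.hβ]⟩ : P.Elt a' b))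
    (fun p p' hp => Elt.ext (by
      refine ((op_congr rfl hp rfl).trans ?_).symm
      refine (op_op_inv _ _ _ _ _ _ _ rfl (p.hy.trans z.hα.symm)).trans ?_
      exact P.unit_left _ _ _)) f

/-- `2⁻¹ ∘ 3 = 2⁻¹ 3` -/
def compBAB {a : P.A} {b b' : P.B} (x : P.Elt a b) (z : P.Elt a b') : P.VFrac b b' :=
  VFrac.mk x.val z.val (x.hα.trans z.hα.symm) x.hβ z.hβ

/-- `3⁻¹ 2 ∘ 1⁻¹ = (1 2⁻¹ 3)⁻¹` -/
def compBBA {a : P.A} {b b' : P.B} (f : P.VFrac b b') (y : P.Elt a b') : P.Elt a b :=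
  Quotient.lift
    (fun p : P.VPair b b' => (⟨P.op y.val p.z p.x (p.hz.trans y.hβ.symm) p.h.symm,
      by rw [P.α_op, y.hα], by rw [P.β_op, p.hx]⟩ : P.Elt a b))
    (fun p p' hp => Elt.ext (by
      refine ((op_congr rfl hp rfl).trans ?_).symm
      refine (op_op_inv _ _ _ _ _ _ _ (p.hz.trans y.hβ.symm) rfl).trans ?_
      exact op_congr rfl rfl (P.unit_right _ _ _))) f

/-- `2⁻¹ 3 ∘ 4⁻¹ 5 = 2⁻¹ (3 4⁻¹ 5)` -/
def compBBB {b b' b'' : P.B} : P.VFrac b b' → P.VFrac b' b'' → P.VFrac b b'' :=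
  Quotient.map₂
    (fun p q =>
      { x := p.x
        z := P.op p.z q.x q.z (q.hx.trans p.hz.symm) q.h
        h := by rw [P.α_op, p.h]
        hx := p.hx
        hz := by rw [P.β_op, q.hz] })
    (fun p p' hp q q' hq => by
      refine (op_congr rfl rfl hq).trans ?_
      refine (P.concat_left _ _ _ _ _ _ (q'.hx.trans p'.hz.symm)).trans ?_
      refine (op_congr hp rfl rfl).trans ?_
      exact op_assoc _ _ _ _ _ _ _ _ _)

lemma compAAA_mk {a a' a'' : P.A} {y x z w : P.X} {h hy hx h' hz hw} :
    compAAA (HFrac.mk (a := a) (a' := a') y x h hy hx) (HFrac.mk (a' := a'') z w h' hz hw) =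
      HFrac.mk (P.op y x z h (hx.trans hz.symm)) w (by rw [P.β_op, h']) (by rw [P.α_op, hy]) hw :=
  rfl

lemma compAAB_mk {a a' : P.A} {b : P.B} {y x z : P.X} {h hy hx hz hz'} :
    compAAB (HFrac.mk (a := a) (a' := a') y x h hy hx) (⟨z, hz, hz'⟩ : P.Elt a' b) =
      ⟨P.op y x z h (hx.trans hz.symm), by rw [P.α_op, hy], by rw [P.β_op, hz']⟩ :=
  rfl

lemma compABB_mk {a : P.A} {b b' : P.B} {y x z : P.X} {h hx hz hy hy'} :
    compABB (⟨y, hy, hy'⟩ : P.Elt a b) (VFrac.mk (b' := b') x z h hx hz) =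
      ⟨P.op y x z (hx.trans hy'.symm) h, by rw [P.α_op, hy], by rw [P.β_op, hz]⟩ :=
  rfl

lemma compBAA_mk {a a' : P.A} {b : P.B} {y x z : P.X} {h hy hx hz hz'} :
    compBAA (⟨z, hz, hz'⟩ : P.Elt a b) (HFrac.mk (a' := a') y x h hy hx) =
      ⟨P.op x y z h.symm (hy.trans hz.symm), by rw [P.α_op, hx], by rw [P.β_op, hz']⟩ :=
  rfl

lemma compBBA_mk {a : P.A} {b b' : P.B} {x z y : P.X} {h hx hz hy hy'} :
    compBBA (VFrac.mk (b := b) x z h hx hz) (⟨y, hy, hy'⟩ : P.Elt a b') =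
      ⟨P.op y z x (hz.trans hy'.symm) h.symm, by rw [P.α_op, hy], by rw [P.β_op, hx]⟩ :=
  rfl

lemma compBBB_mk {b b' b'' : P.B} {x z y w : P.X} {h hx hz h' hy hw} :
    compBBB (VFrac.mk (b := b) (b' := b') x z h hx hz) (VFrac.mk (b' := b'') y w h' hy hw) =
      VFrac.mk x (P.op z y w (hy.trans hz.symm) h') (by rw [P.α_op, h]) hx (by rw [P.β_op, hw]) :=
  rfl

variable (P)

/-- The objects of the enveloping groupoid: the disjoint sum of `A` and `B`. -/
inductive Env : Type u
  | ofA (a : P.A)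
  | ofB (b : P.B)

namespace Env

variable {P}

/-- The arrows of the enveloping groupoid: fractions `y x⁻¹` from `A` to `A`, fractions `x⁻¹ z`
from `B` to `B`, elements `x` of `X` from `A` to `B`, and formal inverses `x⁻¹` of elements of `X`
from `B` to `A`. -/
def Hom : P.Env → P.Env → Type u
  | ofA a, ofA a' => P.HFrac a a'
  | ofA a, ofB b => P.Elt a b
  | ofB b, ofA a => P.Elt a b
  | ofB b, ofB b' => P.VFrac b b'

/-- The units of the enveloping groupoid: `x x⁻¹` for any `x` over `a`, and `x⁻¹ x` for any `x`
over `b`. -/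
noncomputable def unit : (e : P.Env) → Hom e e
  | ofA a => HFrac.mk (P.α_surjective a).choose (P.α_surjective a).choose rfl
      (P.α_surjective a).choose_spec (P.α_surjective a).choose_spec
  | ofB b => VFrac.mk (P.β_surjective b).choose (P.β_surjective b).choose rfl
      (P.β_surjective b).choose_spec (P.β_surjective b).choose_spec

/-- Composition in the enveloping groupoid, written from left to right. -/
def comp : {e e' e'' : P.Env} → Hom e e' → Hom e' e'' → Hom e e''
  | ofA _, ofA _, ofA _, f, g => compAAA f g
  | ofA _, ofA _, ofB _, f, g => compAAB f g
  | ofA _, ofB _, ofA _, f, g => compABA f g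
  | ofA _, ofB _, ofB _, f, g => compABB f g
  | ofB _, ofA _, ofA _, f, g => compBAA f g
  | ofB _, ofA _, ofB _, f, g => compBAB f g
  | ofB _, ofB _, ofA _, f, g => compBBA f g
  | ofB _, ofB _, ofB _, f, g => compBBB f g

/-- Inverses in the enveloping groupoid. -/
def inv : {e e' : P.Env} → Hom e e' → Hom e' e
  | ofA _, ofA _, f =>
      Quotient.map (fun p => ⟨p.x, p.y, p.h.symm, p.hx, p.hy⟩)
        (fun p p' hp => by
          exact ((op_congr rfl rfl hp).trans
            (op_cancel_left p.y p.x p'.x p.h (p.hx.trans p'.hx.symm))).symm) f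
  | ofA _, ofB _, f => f
  | ofB _, ofA _, f => f
  | ofB _, ofB _, f =>
      Quotient.map (fun p => ⟨p.z, p.x, p.h.symm, p.hz, p.hx⟩)
        (fun p p' hp => by
          exact ((op_congr hp rfl rfl).trans
            (op_cancel_right p'.x p.x p.z (p.hx.trans p'.hx.symm) p.h)).symm) f

lemma unit_ofA (x : P.X) (a : P.A) (hx : P.α x = a) :
    unit (ofA a) = HFrac.mk x x rfl hx hx :=
  HFrac.sound (P.unit_left _ _ _).symm

lemma unit_ofB (x : P.X) (b : P.B) (hx : P.β x = b) :
    unit (ofB b) = VFrac.mk x x rfl hx hx :=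
  VFrac.sound (P.unit_right _ _ _).symm

lemma unit_comp : {e e' : P.Env} → (f : Hom e e') → comp (unit e) f = f
  | ofA _, ofA _, f => by
    induction f using HFrac.ind with | mk y x h hy hx
    rw [unit_ofA y _ hy]
    refine Eq.trans compAAA_mk ?_
    exact HFrac.sound (by simp only [P.unit_left, P.unit_right])
  | ofA _, ofB _, f => by
    rw [unit_ofA f.val _ f.hα]
    exact Elt.ext (P.unit_left _ _ _)
  | ofB _, ofA _, f => by
    rw [unit_ofB f.val _ f.hβ]
    exact Elt.ext (P.unit_right _ _ _)
  | ofB _, ofB _, f => by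
    induction f using VFrac.ind with | mk x z h hx hz
    rw [unit_ofB x _ hx]
    refine Eq.trans compBBB_mk ?_
    exact VFrac.sound (by simp only [P.unit_left])

lemma comp_unit : {e e' : P.Env} → (f : Hom e e') → comp f (unit e') = f
  | ofA _, ofA _, f => by
    induction f using HFrac.ind with | mk y x h hy hx
    rw [unit_ofA x _ hx]
    refine Eq.trans compAAA_mk ?_
    exact HFrac.sound (by simp only [P.unit_right])
  | ofA _, ofB _, f => by
    rw [unit_ofB f.val _ f.hβ]
    exact Elt.ext (P.unit_right _ _ _)
  | ofB _, ofA _, f => by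
    rw [unit_ofA f.val _ f.hα]
    exact Elt.ext (P.unit_left _ _ _)
  | ofB _, ofB _, f => by
    induction f using VFrac.ind with | mk x z h hx hz
    rw [unit_ofB z _ hz]
    refine Eq.trans compBBB_mk ?_
    exact VFrac.sound (by simp only [P.unit_left])

lemma inv_comp : {e e' : P.Env} → (f : Hom e e') → comp (inv f) f = unit e'
  | ofA _, ofA _, f => by
    induction f using HFrac.ind with | mk y x h hy hx
    rw [unit_ofA x _ hx]
    exact HFrac.sound (by simp only [P.unit_right])
  | ofA _, ofB _, f => by
    rw [unit_ofB f.val _ f.hβ]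
    rfl
  | ofB _, ofA _, f => by
    rw [unit_ofA f.val _ f.hα]
    rfl
  | ofB _, ofB _, f => by
    induction f using VFrac.ind with | mk x z h hx hz
    rw [unit_ofB z _ hz]
    exact VFrac.sound (by simp only [P.unit_left])

lemma comp_inv : {e e' : P.Env} → (f : Hom e e') → comp f (inv f) = unit e
  | ofA _, ofA _, f => by
    induction f using HFrac.ind with | mk y x h hy hx
    rw [unit_ofA y _ hy]
    exact HFrac.sound (by simp only [P.unit_left, P.unit_right])
  | ofA _, ofB _, f => by
    rw [unit_ofA f.val _ f.hα]
    rfl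
  | ofB _, ofA _, f => by
    rw [unit_ofB f.val _ f.hβ]
    rfl
  | ofB _, ofB _, f => by
    induction f using VFrac.ind with | mk x z h hx hz
    rw [unit_ofB x _ hx]
    exact VFrac.sound (by simp only [P.unit_left])

set_option linter.unusedSimpArgs false in
lemma comp_assoc {e₁ e₂ e₃ e₄ : P.Env} (f : Hom e₁ e₂) (g : Hom e₂ e₃) (k : Hom e₃ e₄) :
    comp (comp f g) k = comp f (comp g k) := by
  cases e₁ <;> cases e₂ <;> cases e₃ <;> cases e₄
  all_goals
    first | induction f using HFrac.ind | induction f using VFrac.ind | cases f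
    first | induction g using HFrac.ind | induction g using VFrac.ind | cases g
    first | induction k using HFrac.ind | induction k using VFrac.ind | cases k
    simp only [comp, compAAA_mk, compAAB_mk, compABA, compABB_mk, compBAA_mk, compBAB, compBBA_mk,
      compBBB_mk]
    first | apply HFrac.sound | apply VFrac.sound | apply Elt.ext
    simp only [op_assoc', op_op_inv', P.concat_left, P.unit_left, P.unit_right]

/-- The enveloping groupoid of a pregroupoid. -/
noncomputable instance : Groupoid.{u} P.Env where
  Hom := Hom
  id := unit
  comp := comp
  id_comp := unit_comp
  comp_id := comp_unit
  assoc := comp_assoc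
  inv := inv
  inv_comp := inv_comp
  comp_inv := comp_inv

/-- The functor from the enveloping groupoid to the groupoid with two objects `a₀ = zero`,
`b₀ = one` and one invertible arrow between them, which sends `A` to `a₀` and `B` to `b₀`. -/
def proj (P : Pregroupoid.{u}) : P.Env ⥤ WalkingIso.{0} where
  obj
    | ofA _ => WalkingIso.zero
    | ofB _ => WalkingIso.one
  map _ := ⟨⟩

variable {Q : Pregroupoid.{u}} (φ : P ⟶ Q)

/-- The effect on fractions `y x⁻¹` of a morphism of pregroupoids. -/
def mapH {a a' : P.A} : P.HFrac a a' → Q.HFrac (φ.mapA a) (φ.mapA a') :=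
  Quotient.map
    (fun p =>
      { y := φ.map p.y
        x := φ.map p.x
        h := by rw [φ.β_map, φ.β_map, p.h]
        hy := by rw [φ.α_map, p.hy]
        hx := by rw [φ.α_map, p.hx] })
    (fun _ _ hp => (congrArg φ.map hp).trans (φ.map_op _ _ _ _ _))

/-- The effect on fractions `x⁻¹ z` of a morphism of pregroupoids. -/
def mapV {b b' : P.B} : P.VFrac b b' → Q.VFrac (φ.mapB b) (φ.mapB b') :=
  Quotient.map
    (fun p =>
      { x := φ.map p.x
        z := φ.map p.z
        h := by rw [φ.α_map, φ.α_map, p.h]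
        hx := by rw [φ.β_map, p.hx]
        hz := by rw [φ.β_map, p.hz] })
    (fun _ _ hp => (congrArg φ.map hp).trans (φ.map_op _ _ _ _ _))

/-- The effect on elements of `X` of a morphism of pregroupoids. -/
def mapElt {a : P.A} {b : P.B} (x : P.Elt a b) : Q.Elt (φ.mapA a) (φ.mapB b) :=
  ⟨φ.map x.val, by rw [φ.α_map, x.hα], by rw [φ.β_map, x.hβ]⟩

/-- The effect on objects of a morphism of pregroupoids. -/
def mapObj : P.Env → Q.Env
  | ofA a => ofA (φ.mapA a)
  | ofB b => ofB (φ.mapB b)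

/-- The effect on arrows of a morphism of pregroupoids. -/
def mapHom : {e e' : P.Env} → Hom e e' → Hom (mapObj φ e) (mapObj φ e')
  | ofA _, ofA _, f => mapH φ f
  | ofA _, ofB _, f => mapElt φ f
  | ofB _, ofA _, f => mapElt φ f
  | ofB _, ofB _, f => mapV φ f

lemma mapHom_unit : (e : P.Env) → mapHom φ (unit e) = unit (mapObj φ e)
  | ofA a => by
    obtain ⟨x, hx⟩ := P.α_surjective a
    rw [unit_ofA x a hx]
    exact (unit_ofA (φ.map x) _ (by rw [φ.α_map, hx])).symm
  | ofB b => by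
    obtain ⟨x, hx⟩ := P.β_surjective b
    rw [unit_ofB x b hx]
    exact (unit_ofB (φ.map x) _ (by rw [φ.β_map, hx])).symm

lemma mapHom_comp {e₁ e₂ e₃ : P.Env} (f : Hom e₁ e₂) (g : Hom e₂ e₃) :
    mapHom φ (comp f g) = comp (mapHom φ f) (mapHom φ g) := by
  cases e₁ <;> cases e₂ <;> cases e₃
  all_goals
    first | induction f using HFrac.ind | induction f using VFrac.ind | cases f
    first | induction g using HFrac.ind | induction g using VFrac.ind | cases g
    first
      | rfl
      | exact HFrac.sound ((φ.map_op _ _ _ _ _).symm.trans (Q.unit_right _ _ _).symm)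
      | exact VFrac.sound ((φ.map_op _ _ _ _ _).symm.trans (Q.unit_left _ _ _).symm)
      | exact Elt.ext (φ.map_op _ _ _ _ _)

/-- The functor between enveloping groupoids induced by a morphism of pregroupoids. -/
def map : P.Env ⥤ Q.Env where
  obj := mapObj φ
  map := mapHom φ
  map_id := mapHom_unit φ
  map_comp := mapHom_comp φ

end Env

end Pregroupoid

/-! ### Fibrations in groupoids over the generic invertible arrow -/

/-- The functor to the groupoid `WalkingIso`, which has two objects `zero` and `one`
and exactly one arrow between any two of them, is a fibration all of whose fibres are
groupoids, and the total category is inhabited. -/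
structure IsInhabitedGroupoidFibration (E : BasedCategory.{u, u} WalkingIso.{0}) : Prop where
  isFibered : E.p.IsFibered
  isGroupoid_fiber (i : WalkingIso.{0}) : IsGroupoid (E.p.Fiber i)
  inhabited : Nonempty E.obj

/-- The category of fibrations-in-groupoids with inhabited total category over the groupoid
with two objects and one invertible arrow between them. The morphisms are the functors which
commute strictly with the projections. -/
abbrev GroupoidFibration : Type (u + 1) :=
  ObjectProperty.FullSubcategory (C := BasedCategory.{u, u} WalkingIso.{0})
    IsInhabitedGroupoidFibration.{u}

lemma isIso_walkingIso {i j : WalkingIso.{0}} (f : i ⟶ j) : IsIso f :=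
  ⟨⟨⟨⟩, rfl, rfl⟩⟩

lemma IsInhabitedGroupoidFibration.isGroupoid {E : BasedCategory.{u, u} WalkingIso.{0}}
    (hE : IsInhabitedGroupoidFibration E) : IsGroupoid E.obj where
  all_isIso {x y} f := by
    have := hE.isFibered
    have := hE.isGroupoid_fiber (E.p.obj x)
    have := isIso_walkingIso (E.p.map f)
    obtain ⟨z, k, hk⟩ := IsPreFibered.exists_isCartesian E.p (rfl : E.p.obj y = _) (E.p.map f)
    have : IsIso k := Functor.IsStronglyCartesian.isIso_of_base_isIso E.p (E.p.map f) k
    have hv : IsIso (Functor.Fiber.homMk E.p (E.p.obj x)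
        (Functor.IsCartesian.map E.p (E.p.map f) k f)) := inferInstance
    have hv' : IsIso (Functor.IsCartesian.map E.p (E.p.map f) k f) :=
      inferInstanceAs (IsIso (Functor.Fiber.fiberInclusion.map
        (Functor.Fiber.homMk E.p (E.p.obj x) (Functor.IsCartesian.map E.p (E.p.map f) k f))))
    rw [← Functor.IsCartesian.fac E.p (E.p.map f) k f]
    infer_instance

lemma Pregroupoid.Env.exists_lift (P : Pregroupoid.{u}) (e : P.Env) (i : WalkingIso.{0}) :
    ∃ (e' : P.Env) (_ : e' ⟶ e), (Env.proj P).obj e' = i := by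
  induction i with
  | zero =>
    cases e with
    | ofA a => exact ⟨ofA a, 𝟙 _, rfl⟩
    | ofB b =>
      obtain ⟨x, hx⟩ := P.β_surjective b
      exact ⟨ofA (P.α x), (⟨x, rfl, hx⟩ : P.Elt (P.α x) b), rfl⟩
  | one =>
    cases e with
    | ofA a =>
      obtain ⟨x, hx⟩ := P.α_surjective a
      exact ⟨ofB (P.β x), (⟨x, hx, rfl⟩ : P.Elt a (P.β x)), rfl⟩
    | ofB b => exact ⟨ofB b, 𝟙 _, rfl⟩

lemma Pregroupoid.Env.isInhabitedGroupoidFibration (P : Pregroupoid.{u}) :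
    IsInhabitedGroupoidFibration (BasedCategory.ofFunctor (Env.proj P)) where
  isFibered := by
    change (Env.proj P).IsFibered
    refine Functor.IsFibered.of_exists_isStronglyCartesian (fun e i f => ?_)
    obtain ⟨e', k, rfl⟩ := Env.exists_lift P e i
    have : f = (Env.proj P).map k := rfl
    subst this
    exact ⟨e', k, inferInstance⟩
  isGroupoid_fiber i := by
    change IsGroupoid ((Env.proj P).Fiber i)
    refine ⟨fun {x y} f => ?_⟩
    have := f.2
    refine ⟨⟨⟨CategoryTheory.inv f.1, inferInstance⟩, ?_, ?_⟩⟩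
    · exact Subtype.ext (IsIso.hom_inv_id f.1)
    · exact Subtype.ext (IsIso.inv_hom_id f.1)
  inhabited := ⟨Env.ofA (P.α P.inhabited.some)⟩

lemma Pregroupoid.Env.map_id (P : Pregroupoid.{u}) : Env.map (𝟙 P) = 𝟭 P.Env := by
  refine CategoryTheory.Functor.hext (fun e => ?_) (fun e e' f => ?_)
  · cases e <;> rfl
  · cases e <;> cases e'
    all_goals
      first | rfl | (induction f using HFrac.ind; rfl) | (induction f using VFrac.ind; rfl)

lemma Pregroupoid.Env.map_comp {P Q R : Pregroupoid.{u}} (φ : P ⟶ Q) (ψ : Q ⟶ R) :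
    Env.map (φ ≫ ψ) = Env.map φ ⋙ Env.map ψ := by
  refine CategoryTheory.Functor.hext (fun e => ?_) (fun e e' f => ?_)
  · cases e <;> rfl
  · cases e <;> cases e'
    all_goals
      first | rfl | (induction f using HFrac.ind; rfl) | (induction f using VFrac.ind; rfl)

lemma Pregroupoid.Env.map_proj {P Q : Pregroupoid.{u}} (φ : P ⟶ Q) :
    Env.map φ ⋙ Env.proj Q = Env.proj P := by
  refine CategoryTheory.Functor.ext (fun e => ?_) (fun _ _ _ => rfl)
  cases e <;> rfl

lemma basedFunctor_ext {E F : BasedCategory.{u, u} WalkingIso.{0}} {f g : BasedFunctor E F}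
    (h : f.toFunctor = g.toFunctor) : f = g := by
  cases f; cases g; cases h; rfl

/-- The functor which sends a pregroupoid to its enveloping groupoid, seen as a fibration over
the groupoid with two objects and one invertible arrow. -/
noncomputable def Pregroupoid.env : Pregroupoid.{u} ⥤ GroupoidFibration.{u} where
  obj P := ⟨BasedCategory.ofFunctor (Env.proj P), Env.isInhabitedGroupoidFibration P⟩
  map φ := ObjectProperty.homMk
    { toFunctor := Env.map φ
      w := Env.map_proj φ }
  map_id P := InducedCategory.hom_ext (basedFunctor_ext (Env.map_id P))
  map_comp φ ψ := InducedCategory.hom_ext (basedFunctor_ext (Env.map_comp φ ψ))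

/-! ### From fibrations to bitorsors -/

section Arrows

lemma arrows_cancel_left {K : Type u} [SmallCategory K] [IsGroupoid K] {a b c : K}
    (g g' : a ⟶ b) (x : b ⟶ c) (e : g ≫ 𝟙 b ≫ x = g' ≫ 𝟙 b ≫ x) : g = g' := by
  simpa [cancel_mono] using e

lemma arrows_cancel_right {K : Type u} [SmallCategory K] [IsGroupoid K] {a b c : K}
    (g g' : b ⟶ c) (x : a ⟶ b) (e : x ≫ 𝟙 b ≫ g = x ≫ 𝟙 b ≫ g') : g = g' := by
  simpa [cancel_epi] using e

lemma arrows_map_comp {K L : Type u} [SmallCategory K] [SmallCategory L] (F : K ⥤ L) {a b c : K}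
    (g : a ⟶ b) (x : b ⟶ c) : F.map (g ≫ 𝟙 b ≫ x) = F.map g ≫ 𝟙 (F.obj b) ≫ F.map x := by
  simp

variable (K : Type u) [SmallCategory K] [IsGroupoid K] (A B : ObjectProperty K)

/-- The set `K(A, B)` of all arrows with domain in `A` and codomain in `B`. -/
structure Arrows : Type u where
  dom : A.FullSubcategory
  cod : B.FullSubcategory
  hom : dom.obj ⟶ cod.obj

/-- The full subgroupoid `K(A, A)` of a groupoid `K`. -/
@[reducible]
noncomputable def fullSubgroupoid : Groupoid A.FullSubcategory :=
  Groupoid.ofIsIso (fun f => (A.isIso_hom_iff f).1 inferInstance)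

/-- `K(A, B)` with the actions of the full subgroupoids `K(A, A)` and `K(B, B)` by pre- and
postcomposition. -/
noncomputable def arrowsBiAction : BiAction.{u} where
  A := A.FullSubcategory
  B := B.FullSubcategory
  X := Arrows K A B
  groupoidA := fullSubgroupoid K A
  groupoidB := fullSubgroupoid K B
  α := Arrows.dom
  β := Arrows.cod
  lact {a a'} g x hx := ⟨a, x.cod, g.hom ≫ eqToHom (by rw [hx]) ≫ x.hom⟩
  α_lact g x hx := rfl
  lact_id := by rintro ⟨a, b, x⟩ _ rfl; simp
  lact_comp := by rintro _ _ _ f g ⟨a, b, x⟩ rfl; simp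
  ract {b b'} x k hx := ⟨x.dom, b', x.hom ≫ eqToHom (by rw [hx]) ≫ k.hom⟩
  β_ract x k hx := rfl
  ract_id := by rintro ⟨a, b, x⟩ _ rfl; simp
  ract_comp := by rintro _ _ _ ⟨a, b, x⟩ f g rfl; simp
  β_lact g x hx := rfl
  α_ract x k hx := rfl
  lact_ract := by rintro _ _ _ _ g ⟨a, b, x⟩ k rfl rfl; simp

lemma arrowsBiAction_isBitorsor (hA : ∀ a : A.FullSubcategory, ∃ b : B.FullSubcategory,
      Nonempty (a.obj ⟶ b.obj))
    (hB : ∀ b : B.FullSubcategory, ∃ a : A.FullSubcategory, Nonempty (a.obj ⟶ b.obj))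
    (h : Nonempty A.FullSubcategory) : (arrowsBiAction K A B).IsBitorsor where
  inhabited := by
    obtain ⟨a⟩ := h
    obtain ⟨b, ⟨x⟩⟩ := hA a
    exact ⟨⟨a, b, x⟩⟩
  α_surjective a := by
    obtain ⟨b, ⟨x⟩⟩ := hA a
    exact ⟨⟨a, b, x⟩, rfl⟩
  β_surjective b := by
    obtain ⟨a, ⟨x⟩⟩ := hB b
    exact ⟨⟨a, b, x⟩, rfl⟩
  lact_free := by
    rintro a _ g g' ⟨a', b, x⟩ rfl e
    have e' : g.hom ≫ 𝟙 a'.obj ≫ x = g'.hom ≫ 𝟙 a'.obj ≫ x := eq_of_heq (Arrows.mk.inj e).2.2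
    exact InducedCategory.hom_ext (arrows_cancel_left _ _ _ e')
  ract_free := by
    rintro _ b' g g' ⟨a, b, x⟩ rfl e
    have e' : x ≫ 𝟙 b.obj ≫ g.hom = x ≫ 𝟙 b.obj ≫ g'.hom := eq_of_heq (Arrows.mk.inj e).2.2
    exact InducedCategory.hom_ext (arrows_cancel_right _ _ _ e')
  β_eq_iff := by
    rintro ⟨a, b, x⟩ ⟨a', b', y⟩
    constructor
    · intro (h : b = b')
      subst h
      refine ⟨a', a, ObjectProperty.homMk (y ≫ inv x), rfl, ?_⟩
      refine congrArg (Arrows.mk a' b) (?_ : (y ≫ inv x) ≫ 𝟙 a.obj ≫ x = y)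
      simp
    · rintro ⟨c, _, g, rfl, e⟩
      exact (Arrows.mk.inj e).2.1
  α_eq_iff := by
    rintro ⟨a, b, x⟩ ⟨a', b', y⟩
    constructor
    · intro (h : a = a')
      subst h
      refine ⟨b, b', ObjectProperty.homMk (inv x ≫ y), rfl, ?_⟩
      refine congrArg (Arrows.mk a b') (?_ : x ≫ 𝟙 b.obj ≫ inv x ≫ y = y)
      simp
    · rintro ⟨_, c, g, rfl, e⟩
      exact (Arrows.mk.inj e).1

end Arrows

namespace GroupoidFibration

/-- The objects of the total category which lie over a given object of the base. -/
def isOver (E : GroupoidFibration.{u}) (i : WalkingIso.{0}) : ObjectProperty E.obj.obj :=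
  fun x => E.obj.p.obj x = i

lemma exists_hom_to (E : GroupoidFibration.{u}) (x : E.obj.obj) (i : WalkingIso.{0}) :
    ∃ y : (E.isOver i).FullSubcategory, Nonempty (y.obj ⟶ x) := by
  have := E.property.isFibered
  let f : i ⟶ E.obj.p.obj x := ⟨⟩
  obtain ⟨y, k, hk⟩ := IsPreFibered.exists_isCartesian E.obj.p rfl f
  exact ⟨⟨y, IsHomLift.domain_eq E.obj.p f k⟩, ⟨k⟩⟩

instance (E : GroupoidFibration.{u}) : IsGroupoid E.obj.obj := E.property.isGroupoid

/-- The bitorsor `E(A, B)` of a fibration-in-groupoids, where `A` and `B` are the sets of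
objects over `zero` and over `one`. -/
noncomputable def bitorsor (E : GroupoidFibration.{u}) : Bitorsor.{u} :=
  ⟨arrowsBiAction E.obj.obj (E.isOver WalkingIso.zero) (E.isOver WalkingIso.one), by
    refine arrowsBiAction_isBitorsor _ _ _ (fun a => ?_) (fun b => ?_) ?_
    · obtain ⟨b, ⟨x⟩⟩ := E.exists_hom_to a.obj WalkingIso.one
      exact ⟨b, ⟨inv x⟩⟩
    · exact E.exists_hom_to b.obj WalkingIso.zero
    · obtain ⟨x⟩ := E.property.inhabited
      obtain ⟨a, -⟩ := E.exists_hom_to x WalkingIso.zero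
      exact ⟨a⟩⟩

variable {E F : GroupoidFibration.{u}} (f : E ⟶ F)

/-- The functor between the full subgroupoids on the objects over `i` which is induced by a
morphism of fibrations. -/
def overMap (i : WalkingIso.{0}) : (E.isOver i).FullSubcategory ⥤ (F.isOver i).FullSubcategory :=
  (F.isOver i).lift ((E.isOver i).ι ⋙ f.hom.toFunctor) (fun x => (f.hom.w_obj x.obj).trans x.property)

/-- The map between the sets of arrows from objects over `zero` to objects over `one` which is
induced by a morphism of fibrations. -/
def arrowsMap (x : Arrows E.obj.obj (E.isOver WalkingIso.zero) (E.isOver WalkingIso.one)) :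
    Arrows F.obj.obj (F.isOver WalkingIso.zero) (F.isOver WalkingIso.one) where
  dom := (overMap f WalkingIso.zero).obj x.dom
  cod := (overMap f WalkingIso.one).obj x.cod
  hom := f.hom.toFunctor.map x.hom

/-- The functor which sends a fibration-in-groupoids `E` to the bitorsor `E(A, B)`. -/
noncomputable def toBitorsor : GroupoidFibration.{u} ⥤ Bitorsor.{u} where
  obj := bitorsor
  map f := ObjectProperty.homMk
    { functorA := overMap f WalkingIso.zero
      functorB := overMap f WalkingIso.one
      map := arrowsMap f
      α_map := fun _ => rfl
      β_map := fun _ => rfl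
      map_lact := by
        rintro a' _ g ⟨a, b, x⟩ rfl
        exact congrArg (Arrows.mk _ _) (arrows_map_comp f.hom.toFunctor g.hom x)
      map_ract := by
        rintro _ b' ⟨a, b, x⟩ k rfl
        exact congrArg (Arrows.mk _ _) (arrows_map_comp f.hom.toFunctor x k.hom) }
  map_id _ := rfl
  map_comp _ _ := rfl

end GroupoidFibration

end Kock

/-! For arrows of a groupoid, `y x⁻¹ z` can be read literally, as the composite of `y`, the inverse
of `x`, and `z`. A bitorsor carries no more information than this operation: since the structural
maps are surjective and the actions are free and transitive on the fibres, every arrow of the left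
groupoid is a fraction `y x⁻¹`, every arrow of the right one is a fraction `x⁻¹ z`, and a morphism
of pregroupoids extends uniquely to the two groupoids. So `Bitorsor.toPregroupoid` is fully faithful
(`exists_map_lact`, `exists_map_ract`).

It remains to compare pregroupoids with fibrations. The arrows from `A` to `B` in an enveloping
groupoid are the elements of the pregroupoid, and the ternary operation is composition there
(`homOf_op`); this gives `arrowsIso`. Conversely, formal fractions of arrows of a fibration can be
evaluated as true composites (`eval`). Evaluation is faithful, because `y x⁻¹ = z w⁻¹` forces `z = y
x⁻¹ w`; it is full, because an arrow inside a fibre becomes a fraction once some arrow to or from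
the other fibre is chosen; it is bijective on objects, because the base has just two objects. It is
therefore a strict isomorphism over the base, which gives `evalIso`.

For bitorsors, cancelling the fully faithful `Bitorsor.toPregroupoid` from `arrowsIso` yields
`envIso`, without a separate comparison of the action groupoids. -/

namespace Kock

/-! ### Full faithfulness of the passage from bitorsors to pregroupoids -/

namespace BiAction

variable {V W : BiAction.{u}}

lemma IsBitorsor.exists_lact_eq (hW : W.IsBitorsor) {a a' : W.A} (x y : W.X)
    (h : W.β x = W.β y) (hx : W.α x = a') (hy : W.α y = a) :
    ∃ g : a ⟶ a', W.lact g x hx = y := by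
  subst hx hy
  exact ⟨_, hW.fraction_lact x y h⟩

lemma IsBitorsor.exists_ract_eq (hW : W.IsBitorsor) {b b' : W.B} (x y : W.X)
    (h : W.α x = W.α y) (hx : W.β x = b) (hy : W.β y = b') :
    ∃ k : b ⟶ b', W.ract x k hx = y := by
  obtain ⟨c, c', k, h₁, h₂⟩ := (hW.α_eq_iff x y).1 h
  obtain rfl : c = b := h₁.symm.trans hx
  obtain rfl : c' = b' := by rw [← hy, ← h₂, W.β_ract]
  exact ⟨k, h₂⟩

/-- Heterogeneous freeness serves to compare two functors whose values on objects agree only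
propositionally. -/
lemma IsBitorsor.lact_free_heq (hW : W.IsBitorsor) {a a' b b' : W.A} (g : a ⟶ a') (k : b ⟶ b')
    (x : W.X) (hx : W.α x = a') (hx' : W.α x = b') (e : W.lact g x hx = W.lact k x hx') :
    g ≍ k := by
  obtain rfl : a' = b' := hx.symm.trans hx'
  obtain rfl : a = b := by rw [← W.α_lact g x hx, e, W.α_lact]
  exact heq_of_eq (hW.lact_free g k x hx e)

lemma IsBitorsor.ract_free_heq (hW : W.IsBitorsor) {a a' b b' : W.B} (g : a ⟶ a') (k : b ⟶ b')
    (x : W.X) (hx : W.β x = a) (hx' : W.β x = b) (e : W.ract x g hx = W.ract x k hx') :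
    g ≍ k := by
  obtain rfl : a = b := hx.symm.trans hx'
  obtain rfl : a' = b' := by rw [← W.β_ract x g hx, e, W.β_ract]
  exact heq_of_eq (hW.ract_free g k x hx e)

lemma lact_congr {a a' : W.A} (g : a ⟶ a') {x y : W.X} (e : x = y) (hx : W.α x = a') :
    W.lact g x hx = W.lact g y (e ▸ hx) := by
  subst e; rfl

lemma ract_congr {b b' : W.B} (k : b ⟶ b') {x y : W.X} (e : x = y) (hx : W.β x = b) :
    W.ract x k hx = W.ract y k (e ▸ hx) := by
  subst e; rfl

/-- In the pregroupoid of a bitorsor, `(g · x) x⁻¹ z = g · z`. -/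
lemma IsBitorsor.op_lact (hW : W.IsBitorsor) {a a' : W.A} (g : a ⟶ a') (x y z : W.X)
    (hx : W.α x = a') (hy : W.lact g x hx = y) (h : W.β x = W.β y) (h' : W.α x = W.α z) :
    hW.toPregroupoid.op y x z h h' = W.lact g z (h'.symm.trans hx) :=
  hW.fraction_lact_eq x y h g hx hy z h'

/-- In the pregroupoid of a bitorsor, `y x⁻¹ (x · k) = y · k`. -/
lemma IsBitorsor.op_ract (hW : W.IsBitorsor) {b b' : W.B} (k : b ⟶ b') (x y z : W.X)
    (hx : W.β x = b) (hz : W.ract x k hx = z) (h : W.β x = W.β y) (h' : W.α x = W.α z) :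
    hW.toPregroupoid.op y x z h h' = W.ract y k (h.symm.trans hx) := by
  -- The operation is defined through the left action. With `y = g · x`, commutation of the two
  -- actions gives `g · (x · k) = (g · x) · k = y · k`.
  obtain ⟨g, hg⟩ := hW.exists_lact_eq x y h rfl rfl
  rw [hW.op_lact g x y z rfl hg h h']
  subst hz
  rw [W.lact_ract g x k rfl hx]
  exact ract_congr _ hg _

variable (hV : V.IsBitorsor) (hW : W.IsBitorsor) (φ : hV.toPregroupoid ⟶ hW.toPregroupoid)


/-- One point `x` over `a'` determines `k`, as the fraction of `φ (g · x)` by `φ x`. The same `k`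
works for every `z` over `a'`, because `g · z = (g · x) x⁻¹ z` and `φ` preserves the operation. -/
lemma exists_map_lact {a a' : V.A} (g : a ⟶ a') :
    ∃ k : Quiver.Hom (V := W.A) (φ.mapA a) (φ.mapA a'), ∀ (x : V.X) (hx : V.α x = a'),
      φ.map (V.lact g x hx) = W.lact k (φ.map x) ((φ.α_map x).trans (congrArg φ.mapA hx)) := by
  obtain ⟨x, hx⟩ := hV.α_surjective a'
  have hβ : W.β (φ.map x) = W.β (φ.map (V.lact g x hx)) :=
    (φ.β_map x).trans ((congrArg φ.mapB (V.β_lact g x hx).symm).trans (φ.β_map _).symm)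
  obtain ⟨k, hk⟩ := hW.exists_lact_eq (φ.map x) (φ.map (V.lact g x hx)) hβ
    ((φ.α_map x).trans (congrArg φ.mapA hx))
    ((φ.α_map _).trans (congrArg φ.mapA (V.α_lact g x hx)))
  refine ⟨k, fun z hz => ?_⟩
  have e := hV.op_lact g x _ z hx rfl (V.β_lact g x hx).symm (hx.trans hz.symm)
  exact (congrArg φ.map e.symm).trans ((φ.map_op _ _ _ _ _).trans (hW.op_lact k _ _ _ _ hk _ _))

/-- The mirror image rests on `y · g = y x⁻¹ (x · g)`. -/
lemma exists_map_ract {b b' : V.B} (g : b ⟶ b') :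
    ∃ k : Quiver.Hom (V := W.B) (φ.mapB b) (φ.mapB b'), ∀ (x : V.X) (hx : V.β x = b),
      φ.map (V.ract x g hx) = W.ract (φ.map x) k ((φ.β_map x).trans (congrArg φ.mapB hx)) := by
  obtain ⟨x, hx⟩ := hV.β_surjective b
  have hα : W.α (φ.map x) = W.α (φ.map (V.ract x g hx)) :=
    (φ.α_map x).trans ((congrArg φ.mapA (V.α_ract x g hx).symm).trans (φ.α_map _).symm)
  obtain ⟨k, hk⟩ := hW.exists_ract_eq (φ.map x) (φ.map (V.ract x g hx)) hα
    ((φ.β_map x).trans (congrArg φ.mapB hx))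
    ((φ.β_map _).trans (congrArg φ.mapB (V.β_ract x g hx)))
  refine ⟨k, fun y hy => ?_⟩
  have e := hV.op_ract g x y _ hx rfl (hx.trans hy.symm) (V.α_ract x g hx).symm
  exact (congrArg φ.map e.symm).trans ((φ.map_op _ _ _ _ _).trans (hW.op_ract k _ _ _ _ hk _ _))

/-- The functor between left groupoids determined by a morphism of pregroupoids. -/
noncomputable def functorAOfPregroupoidHom : V.A ⥤ W.A where
  obj := φ.mapA
  map g := (exists_map_lact hV hW φ g).choose
  map_id a := by
    obtain ⟨x, hx⟩ := hV.α_surjective a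
    -- By freeness, an equation between arrows may be tested on a single point.
    refine hW.lact_free _ _ (φ.map x) ((φ.α_map x).trans (congrArg φ.mapA hx)) ?_
    exact ((exists_map_lact hV hW φ (𝟙 a)).choose_spec x hx).symm.trans
      ((congrArg φ.map (V.lact_id x hx)).trans (W.lact_id (φ.map x) _).symm)
  map_comp {a a' a''} f g := by
    obtain ⟨x, hx⟩ := hV.α_surjective a''
    refine hW.lact_free _ _ (φ.map x) ((φ.α_map x).trans (congrArg φ.mapA hx)) ?_
    refine ((exists_map_lact hV hW φ (f ≫ g)).choose_spec x hx).symm.trans ?_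
    refine (congrArg φ.map (V.lact_comp f g x hx)).trans ?_
    refine ((exists_map_lact hV hW φ f).choose_spec _ _).trans ?_
    refine Eq.trans ?_ (W.lact_comp _ _ (φ.map x) _).symm
    exact lact_congr _ ((exists_map_lact hV hW φ g).choose_spec x hx) _

/-- The functor between right groupoids determined by a morphism of pregroupoids. -/
noncomputable def functorBOfPregroupoidHom : V.B ⥤ W.B where
  obj := φ.mapB
  map g := (exists_map_ract hV hW φ g).choose
  map_id b := by
    obtain ⟨x, hx⟩ := hV.β_surjective b
    refine hW.ract_free _ _ (φ.map x) ((φ.β_map x).trans (congrArg φ.mapB hx)) ?_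
    exact ((exists_map_ract hV hW φ (𝟙 b)).choose_spec x hx).symm.trans
      ((congrArg φ.map (V.ract_id x hx)).trans (W.ract_id (φ.map x) _).symm)
  map_comp {b b' b''} f g := by
    obtain ⟨x, hx⟩ := hV.β_surjective b
    refine hW.ract_free _ _ (φ.map x) ((φ.β_map x).trans (congrArg φ.mapB hx)) ?_
    refine ((exists_map_ract hV hW φ (f ≫ g)).choose_spec x hx).symm.trans ?_
    refine (congrArg φ.map (V.ract_comp x f g hx)).trans ?_
    refine ((exists_map_ract hV hW φ g).choose_spec _ _).trans ?_
    refine Eq.trans ?_ (W.ract_comp (φ.map x) _ _ _).symm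
    exact ract_congr _ ((exists_map_ract hV hW φ f).choose_spec x hx) _

/-- The morphism of bi-actions determined by a morphism of pregroupoids. -/
noncomputable def homOfPregroupoidHom : V ⟶ W where
  functorA := functorAOfPregroupoidHom hV hW φ
  functorB := functorBOfPregroupoidHom hV hW φ
  map := φ.map
  α_map := φ.α_map
  β_map := φ.β_map
  map_lact g x hx := (exists_map_lact hV hW φ g).choose_spec x hx
  map_ract x k hx := (exists_map_ract hV hW φ k).choose_spec x hx

end BiAction

instance : Bitorsor.toPregroupoid.{u}.Full where
  map_surjective {V W} φ :=
    ⟨ObjectProperty.homMk (BiAction.homOfPregroupoidHom V.property W.property φ), rfl⟩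

/-- An arrow is determined by its effect on one point, so the map on `X` and the maps on objects
determine both functors. -/
instance : Bitorsor.toPregroupoid.{u}.Faithful where
  map_injective {V W f g} e := by
    have hA : f.hom.functorA.obj = g.hom.functorA.obj := congrArg Pregroupoid.Hom.mapA e
    have hB : f.hom.functorB.obj = g.hom.functorB.obj := congrArg Pregroupoid.Hom.mapB e
    have hX : f.hom.map = g.hom.map := congrArg Pregroupoid.Hom.map e
    refine InducedCategory.hom_ext (BiAction.Hom.ext ?_ ?_ hX)
    · refine CategoryTheory.Functor.hext (congrFun hA) (fun a a' k => ?_)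
      obtain ⟨x, hx⟩ := V.property.α_surjective a'
      refine W.property.lact_free_heq _ _ (f.hom.map x) ((f.hom.α_map x).trans (by rw [hx]))
        ((f.hom.α_map x).trans (by rw [hx, hA])) ?_
      rw [← f.hom.map_lact k x hx, congrFun hX, g.hom.map_lact k x hx]
      exact BiAction.lact_congr _ (congrFun hX x).symm _
    · refine CategoryTheory.Functor.hext (congrFun hB) (fun b b' k => ?_)
      obtain ⟨x, hx⟩ := V.property.β_surjective b
      refine W.property.ract_free_heq _ _ (f.hom.map x) ((f.hom.β_map x).trans (by rw [hx]))
        ((f.hom.β_map x).trans (by rw [hx, hB])) ?_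
      rw [← f.hom.map_ract x k hx, congrFun hX, g.hom.map_ract x k hx]
      exact BiAction.ract_congr _ (congrFun hX x).symm _

/-! ### Recovering a pregroupoid from its enveloping groupoid -/

lemma Pregroupoid.isIso_of_bijective {P Q : Pregroupoid.{u}} (φ : P ⟶ Q)
    (hA : Function.Bijective φ.mapA) (hB : Function.Bijective φ.mapB)
    (hX : Function.Bijective φ.map) : IsIso φ := by
  obtain ⟨fA, hA₁, hA₂⟩ := Function.bijective_iff_has_inverse.1 hA
  obtain ⟨fB, hB₁, hB₂⟩ := Function.bijective_iff_has_inverse.1 hB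
  obtain ⟨f, h₁, h₂⟩ := Function.bijective_iff_has_inverse.1 hX
  let ψ : Q ⟶ P :=
    { mapA := fA
      mapB := fB
      map := f
      -- Each condition on the inverse maps is tested after applying an injective component of `φ`.
      α_map := fun x => hA.1 (by rw [← φ.α_map, h₂, hA₂])
      β_map := fun x => hB.1 (by rw [← φ.β_map, h₂, hB₂])
      map_op := fun y x z h h' => hX.1 (by
        rw [φ.map_op, h₂]
        exact op_congr (h₂ y).symm (h₂ x).symm (h₂ z).symm) }
  exact ⟨ψ, Pregroupoid.Hom.ext (funext hA₁) (funext hB₁) (funext h₁),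
    Pregroupoid.Hom.ext (funext hA₂) (funext hB₂) (funext h₂)⟩

section Arrows

variable {K : Type u} [SmallCategory K] [IsGroupoid K] {A B : ObjectProperty K}

/-- In the pregroupoid of the arrows from `A` to `B` in a groupoid, `y x⁻¹ z` is
the composite of `y`, the inverse of `x`, and `z`. -/
lemma arrows_op (hW : (arrowsBiAction K A B).IsBitorsor) {a a' : A.FullSubcategory}
    {b b' : B.FullSubcategory} (y : a.obj ⟶ b.obj) (x : a'.obj ⟶ b.obj) (z : a'.obj ⟶ b'.obj) :
    hW.toPregroupoid.op (Arrows.mk a b y) (Arrows.mk a' b x) (Arrows.mk a' b' z) rfl rfl =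
      Arrows.mk a b' (y ≫ inv x ≫ z) := by
  refine (hW.fraction_lact_eq (Arrows.mk a' b x) (Arrows.mk a b y) rfl
    (a := a) (a' := a') (ObjectProperty.homMk (y ≫ inv x)) rfl ?_
    (Arrows.mk a' b' z) rfl).trans ?_
  -- The identity in the middle is the `eqToHom` in the definition of the action.
  · refine congrArg (Arrows.mk a b) (?_ : (y ≫ inv x) ≫ 𝟙 a'.obj ≫ x = y)
    simp
  · refine congrArg (Arrows.mk a b') (?_ : (y ≫ inv x) ≫ 𝟙 a'.obj ≫ z = y ≫ inv x ≫ z)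
    simp

end Arrows

namespace Pregroupoid

/-- The element `x` of a pregroupoid over `a` and `b`, as an arrow of the enveloping groupoid. -/
def Env.homOf {P : Pregroupoid.{u}} {a : P.A} {b : P.B} (x : P.X) (hα : P.α x = a)
    (hβ : P.β x = b) : (Env.ofA a : P.Env) ⟶ Env.ofB b :=
  (⟨x, hα, hβ⟩ : P.Elt a b)

/-- Composing the formal inverse of `x` with `z` gives the fraction `x⁻¹ z`, and composing `y` with
that gives `y x⁻¹ z` by definition. The endpoints are free parameters because those of `y x⁻¹ z`
agree with those of `y` and `z` only propositionally. -/
lemma Env.homOf_op {P : Pregroupoid.{u}} {a a' : P.A} {b b' : P.B} {y x z : P.X}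
    (hy : P.α y = a) (hy' : P.β y = b) (hx : P.α x = a') (hx' : P.β x = b) (hz : P.α z = a')
    (hz' : P.β z = b') :
    Env.homOf (P.op y x z (hx'.trans hy'.symm) (hx.trans hz.symm)) ((P.α_op _ _ _ _ _).trans hy)
        ((P.β_op _ _ _ _ _).trans hz') =
      Env.homOf y hy hy' ≫ CategoryTheory.inv (Env.homOf x hx hx') ≫ Env.homOf z hz hz' := by
  rw [← Groupoid.inv_eq_inv]
  exact Elt.ext rfl

lemma Env.homOf_injective {P : Pregroupoid.{u}} {a : P.A} {b : P.B} {x y : P.X} {hx hx' hy hy'}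
    (e : (Env.homOf x hx hx' : (Env.ofA a : P.Env) ⟶ Env.ofB b) = Env.homOf y hy hy') : x = y :=
  congrArg Elt.val e

/-- The element `x` of a pregroupoid, as an element of the set of arrows from `A` to `B` in the
enveloping groupoid. -/
def Env.arrow (P : Pregroupoid.{u}) (x : P.X) :
    Arrows P.Env (GroupoidFibration.isOver (env.obj P) WalkingIso.zero)
      (GroupoidFibration.isOver (env.obj P) WalkingIso.one) where
  dom := ⟨Env.ofA (P.α x), rfl⟩
  cod := ⟨Env.ofB (P.β x), rfl⟩
  hom := Env.homOf x rfl rfl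

lemma Env.arrow_eq {P : Pregroupoid.{u}} {a : P.A} {b : P.B} (x : P.X) (hα : P.α x = a)
    (hβ : P.β x = b) :
    Env.arrow P x = ⟨⟨Env.ofA a, rfl⟩, ⟨Env.ofB b, rfl⟩, Env.homOf x hα hβ⟩ := by
  subst hα hβ; rfl

/-- The morphism from a pregroupoid to the pregroupoid of the arrows from `A` to `B` in its
enveloping groupoid. -/
noncomputable def toArrows (P : Pregroupoid.{u}) :
    P ⟶ (env ⋙ GroupoidFibration.toBitorsor ⋙ Bitorsor.toPregroupoid).obj P where
  mapA a := ⟨Env.ofA a, rfl⟩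
  mapB b := ⟨Env.ofB b, rfl⟩
  map := Env.arrow P
  α_map _ := rfl
  β_map _ := rfl
  map_op y x z h h' := by
    -- The endpoints are moved to those of `y` and `z`, the arrow becomes a composite by `homOf_op`,
    -- and `arrows_op` recognises that composite as a ternary operation, with `x` and `z` placed
    -- over matching endpoints.
    refine (Env.arrow_eq (P.op y x z h h') (P.α_op _ _ _ _ _) (P.β_op _ _ _ _ _)).trans ?_
    refine (congrArg (Arrows.mk _ _) (Env.homOf_op rfl rfl rfl h h'.symm rfl)).trans ?_
    refine (arrows_op (K := (env.obj P).obj.obj) (GroupoidFibration.bitorsor (env.obj P)).property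
      (a := ⟨Env.ofA (P.α y), rfl⟩) (a' := ⟨Env.ofA (P.α x), rfl⟩) (b := ⟨Env.ofB (P.β y), rfl⟩)
      (b' := ⟨Env.ofB (P.β z), rfl⟩) (Env.homOf y rfl rfl) (Env.homOf x rfl h)
      (Env.homOf z h'.symm rfl)).symm.trans ?_
    exact op_congr rfl (Env.arrow_eq x rfl h).symm (Env.arrow_eq z h'.symm rfl).symm

lemma toArrows_bijective_A (P : Pregroupoid.{u}) : Function.Bijective P.toArrows.mapA := by
  constructor
  · rintro a a' e
    exact Env.ofA.inj (congrArg ObjectProperty.FullSubcategory.obj e)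
  · rintro ⟨a | b, h⟩
    · exact ⟨a, rfl⟩
    · cases h

lemma toArrows_bijective_B (P : Pregroupoid.{u}) : Function.Bijective P.toArrows.mapB := by
  constructor
  · rintro b b' e
    exact Env.ofB.inj (congrArg ObjectProperty.FullSubcategory.obj e)
  · rintro ⟨a | b, h⟩
    · cases h
    · exact ⟨b, rfl⟩

lemma toArrows_bijective (P : Pregroupoid.{u}) : Function.Bijective P.toArrows.map := by
  constructor
  · rintro x y (e : Env.arrow P x = Env.arrow P y)
    -- Identifying the endpoints first makes the equality of the underlying arrows homogeneous.
    have hα : P.α x = P.α y := P.toArrows_bijective_A.1 (congrArg Arrows.dom e)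
    have hβ : P.β x = P.β y := P.toArrows_bijective_B.1 (congrArg Arrows.cod e)
    rw [Env.arrow_eq x hα hβ] at e
    exact Env.homOf_injective (eq_of_heq (Arrows.mk.inj e).2.2)
  · rintro ⟨⟨a | b, h⟩, ⟨a' | b', h'⟩, x⟩
    · cases h'
    · obtain ⟨x, hx, hx'⟩ : P.Elt a b' := x
      exact ⟨x, Env.arrow_eq x hx hx'⟩
    · cases h
    · cases h

/-- Every pregroupoid is naturally isomorphic to the pregroupoid of the arrows from `A` to `B` in
its enveloping groupoid. -/
noncomputable def arrowsIso :
    𝟭 Pregroupoid.{u} ≅ env ⋙ GroupoidFibration.toBitorsor ⋙ Bitorsor.toPregroupoid :=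
  NatIso.ofComponents
    (fun P =>
      have := isIso_of_bijective P.toArrows P.toArrows_bijective_A P.toArrows_bijective_B
        P.toArrows_bijective
      asIso P.toArrows)
    -- Both sides of the naturality square carry the same element `f.map x`; only its recorded
    -- endpoints differ, and `arrow_eq` reconciles them.
    (fun f => Pregroupoid.Hom.ext rfl rfl
      (funext fun x => Env.arrow_eq (f.map x) (f.α_map x) (f.β_map x)))

end Pregroupoid

/-! ### Evaluation of formal fractions in a groupoid -/

namespace Arrows

variable {K : Type u} [SmallCategory K] {A B : ObjectProperty K}

/-- An arrow from `A` to `B` as an arrow between prescribed objects. -/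
def homBetween (x : Arrows K A B) {a : A.FullSubcategory} {b : B.FullSubcategory}
    (ha : x.dom = a) (hb : x.cod = b) : a.obj ⟶ b.obj :=
  eqToHom (by rw [ha]) ≫ x.hom ≫ eqToHom (by rw [hb])

lemma homBetween_eq {x : Arrows K A B} {a : A.FullSubcategory} {b : B.FullSubcategory}
    {f : a.obj ⟶ b.obj} (e : x = Arrows.mk a b f) (ha : x.dom = a) (hb : x.cod = b) :
    x.homBetween ha hb = f := by
  subst e
  simp [homBetween]

lemma mk_homBetween (x : Arrows K A B) {a : A.FullSubcategory} {b : B.FullSubcategory}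
    (ha : x.dom = a) (hb : x.cod = b) : Arrows.mk a b (x.homBetween ha hb) = x := by
  subst ha hb
  simp [homBetween]

end Arrows

namespace Pregroupoid

section Eval

variable {K : Type u} [SmallCategory K] [IsGroupoid K] {A B : ObjectProperty K}
  (hW : (arrowsBiAction K A B).IsBitorsor)

/-- The object of the groupoid given by an element of `A`. -/
def evalA (a : hW.toPregroupoid.A) : K := ObjectProperty.FullSubcategory.obj a

/-- The object of the groupoid given by an element of `B`. -/
def evalB (b : hW.toPregroupoid.B) : K := ObjectProperty.FullSubcategory.obj b

/-- An element of the pregroupoid of arrows from `A` to `B`, as an arrow between prescribed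
objects. -/
def evalElt {a : hW.toPregroupoid.A} {b : hW.toPregroupoid.B} (x : hW.toPregroupoid.X)
    (ha : hW.toPregroupoid.α x = a) (hb : hW.toPregroupoid.β x = b) : evalA hW a ⟶ evalB hW b :=
  Arrows.homBetween x ha hb

/-- Once `y`, `x`, `z` are rewritten as arrows with literally matching endpoints, `arrows_op`
applies. Well-definedness, functoriality and faithfulness of evaluation all rest on this formula. -/
lemma evalElt_op {a a' : hW.toPregroupoid.A} {b b' : hW.toPregroupoid.B}
    {y x z : hW.toPregroupoid.X} (hy : hW.toPregroupoid.α y = a) (hy' : hW.toPregroupoid.β y = b)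
    (hx : hW.toPregroupoid.α x = a') (hx' : hW.toPregroupoid.β x = b)
    (hz : hW.toPregroupoid.α z = a') (hz' : hW.toPregroupoid.β z = b') :
    evalElt hW (hW.toPregroupoid.op y x z (hx'.trans hy'.symm) (hx.trans hz.symm))
        ((hW.toPregroupoid.α_op _ _ _ _ _).trans hy)
        ((hW.toPregroupoid.β_op _ _ _ _ _).trans hz') =
      evalElt hW y hy hy' ≫ inv (evalElt hW x hx hx') ≫ evalElt hW z hz hz' :=
  Arrows.homBetween_eq ((op_congr (Arrows.mk_homBetween y hy hy').symm
    (Arrows.mk_homBetween x hx hx').symm (Arrows.mk_homBetween z hz hz').symm).trans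
      (arrows_op hW _ _ _)) _ _

lemma evalElt_congr {a : hW.toPregroupoid.A} {b : hW.toPregroupoid.B} {x x' : hW.toPregroupoid.X}
    (e : x = x') (ha : hW.toPregroupoid.α x = a) (hb : hW.toPregroupoid.β x = b) :
    evalElt hW x ha hb = evalElt hW x' (e ▸ ha) (e ▸ hb) := by
  subst e; rfl

/-- The value `y x⁻¹` of a fraction. -/
noncomputable def evalH {a a' : hW.toPregroupoid.A} (f : hW.toPregroupoid.HFrac a a') :
    evalA hW a ⟶ evalA hW a' :=
  Quotient.lift
    (fun p : hW.toPregroupoid.HPair a a' =>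
      evalElt hW p.y p.hy rfl ≫ inv (evalElt hW p.x p.hx p.h))
    (fun p q hpq => by
      -- For equivalent pairs, `u = y x⁻¹ z` becomes an equation of composites, and cancelling `z`
      -- gives `u z⁻¹ = y x⁻¹`.
      rw [evalElt_congr hW hpq q.hy rfl, evalElt_op hW p.hy rfl p.hx p.h q.hx q.h]
      simp) f

/-- The value `x⁻¹ z` of a fraction. -/
noncomputable def evalV {b b' : hW.toPregroupoid.B} (f : hW.toPregroupoid.VFrac b b') :
    evalB hW b ⟶ evalB hW b' :=
  Quotient.lift
    (fun p : hW.toPregroupoid.VPair b b' =>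
      inv (evalElt hW p.x rfl p.hx) ≫ evalElt hW p.z p.h.symm p.hz)
    (fun p q hpq => by
      rw [evalElt_congr hW hpq q.h.symm q.hz, evalElt_op hW rfl q.hx rfl p.hx p.h.symm p.hz]
      simp) f

/-- The definition of `evalH` passes through the object `β y`; here the middle object may be any `b`
equal to it. -/
lemma evalH_mk {a a' : hW.toPregroupoid.A} {b : hW.toPregroupoid.B} {y x : hW.toPregroupoid.X}
    (hy : hW.toPregroupoid.α y = a) (hx : hW.toPregroupoid.α x = a')
    (hy' : hW.toPregroupoid.β y = b) (hx' : hW.toPregroupoid.β x = b) :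
    evalH hW (HFrac.mk y x (hx'.trans hy'.symm) hy hx) = evalElt hW y hy hy' ≫ inv (evalElt hW x hx hx') := by
  subst hy'; rfl

lemma evalV_mk {a : hW.toPregroupoid.A} {b b' : hW.toPregroupoid.B} {x z : hW.toPregroupoid.X}
    (hx : hW.toPregroupoid.β x = b) (hz : hW.toPregroupoid.β z = b')
    (hx' : hW.toPregroupoid.α x = a) (hz' : hW.toPregroupoid.α z = a) :
    evalV hW (VFrac.mk x z (hx'.trans hz'.symm) hx hz) = inv (evalElt hW x hx' hx) ≫ evalElt hW z hz' hz := by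
  subst hx'; rfl

/-- The effect on objects of the evaluation functor. -/
def evalObj : hW.toPregroupoid.Env → K
  | Env.ofA a => evalA hW a
  | Env.ofB b => evalB hW b

/-- The effect on arrows of the evaluation functor. -/
noncomputable def evalHom : {e e' : hW.toPregroupoid.Env} → Env.Hom e e' →
    (evalObj hW e ⟶ evalObj hW e')
  | Env.ofA _, Env.ofA _, f => evalH hW f
  | Env.ofA _, Env.ofB _, f => evalElt hW f.val f.hα f.hβ
  | Env.ofB b, Env.ofA a, f => (inv (evalElt hW f.val f.hα f.hβ) : evalB hW b ⟶ evalA hW a)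
  | Env.ofB _, Env.ofB _, f => evalV hW f

lemma evalHom_unit : (e : hW.toPregroupoid.Env) → evalHom hW (Env.unit e) = 𝟙 (evalObj hW e)
  | Env.ofA a => by
    obtain ⟨x, hx⟩ := hW.toPregroupoid.α_surjective a
    rw [Env.unit_ofA x a hx]
    exact (evalH_mk hW hx hx rfl rfl).trans (IsIso.hom_inv_id _)
  | Env.ofB b => by
    obtain ⟨x, hx⟩ := hW.toPregroupoid.β_surjective b
    rw [Env.unit_ofB x b hx]
    exact (evalV_mk hW hx hx rfl rfl).trans (IsIso.inv_hom_id _)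

/-- Each of the eight composition rules of the enveloping groupoid becomes, through `evalElt_op`, an
identity valid for composites and inverses in any groupoid. -/
lemma evalHom_comp : {e₁ e₂ e₃ : hW.toPregroupoid.Env} → (f : Env.Hom e₁ e₂) →
    (g : Env.Hom e₂ e₃) → evalHom hW (Env.comp f g) = evalHom hW f ≫ evalHom hW g
  | Env.ofA _, Env.ofA _, Env.ofA _, f, g => by
    induction f using HFrac.ind with | mk y x h hy hx
    induction g using HFrac.ind with | mk z w h' hz hw
    refine (evalH_mk hW ((hW.toPregroupoid.α_op _ _ _ _ _).trans hy) hw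
      (hW.toPregroupoid.β_op _ _ _ _ _) h').trans ?_
    refine Eq.trans ?_ (congrArg₂ (· ≫ ·) (evalH_mk hW hy hx rfl h)
      (evalH_mk hW hz hw rfl h')).symm
    rw [evalElt_op hW hy rfl hx h hz rfl]
    simp
  | Env.ofA _, Env.ofA _, Env.ofB _, f, g => by
    induction f using HFrac.ind with | mk y x h hy hx
    refine (evalElt_op hW hy rfl hx h g.hα g.hβ).trans ?_
    exact (Category.assoc _ _ _).symm
  | Env.ofA _, Env.ofB _, Env.ofA _, f, g => evalH_mk hW f.hα g.hα f.hβ g.hβ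
  | Env.ofA _, Env.ofB _, Env.ofB _, f, g => by
    induction g using VFrac.ind with | mk x z h hx hz
    exact evalElt_op hW f.hα f.hβ rfl hx h.symm hz
  | Env.ofB _, Env.ofA _, Env.ofA _, f, g => by
    induction g using HFrac.ind with | mk y x h hy hx
    -- The formal composite is `(x y⁻¹ z)⁻¹`, where `f` stands for `z⁻¹`; inverting the evaluated
    -- composite gives `z⁻¹ y x⁻¹`.
    refine (congrArg (fun k => inv k) (evalElt_op hW hx h hy rfl f.hα f.hβ)).trans ?_
    refine Eq.trans ?_ (congrArg₂ (· ≫ ·) rfl (evalH_mk hW hy hx rfl h)).symm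
    simp [evalHom]
  | Env.ofB _, Env.ofA _, Env.ofB _, f, g => evalV_mk hW f.hβ g.hβ f.hα g.hα
  | Env.ofB _, Env.ofB _, Env.ofA _, f, g => by
    induction f using VFrac.ind with | mk x z h hx hz
    refine (congrArg (fun k => inv k) (evalElt_op hW g.hα g.hβ h.symm hz rfl hx)).trans ?_
    refine Eq.trans ?_ (congrArg₂ (· ≫ ·) (evalV_mk hW hx hz rfl h.symm) rfl).symm
    simp [evalHom]
  | Env.ofB _, Env.ofB _, Env.ofB _, f, g => by
    induction f using VFrac.ind with | mk x z h hx hz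
    induction g using VFrac.ind with | mk y w h' hy hw
    refine (evalV_mk hW hx ((hW.toPregroupoid.β_op _ _ _ _ _).trans hw) h
      (hW.toPregroupoid.α_op _ _ _ _ _)).trans ?_
    refine Eq.trans ?_ (congrArg₂ (· ≫ ·) (evalV_mk hW hx hz h rfl)
      (evalV_mk hW hy hw rfl h'.symm)).symm
    rw [evalElt_op hW rfl hz rfl hy h'.symm hw]
    simp

/-- The evaluation functor from the enveloping groupoid of the arrows from `A` to `B` in a
groupoid to that groupoid. -/
noncomputable def eval : hW.toPregroupoid.Env ⥤ K where
  obj := evalObj hW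
  map := evalHom hW
  map_id := evalHom_unit hW
  map_comp := evalHom_comp hW

lemma evalElt_injective {a : hW.toPregroupoid.A} {b : hW.toPregroupoid.B}
    {x y : hW.toPregroupoid.X} (hx : hW.toPregroupoid.α x = a) (hx' : hW.toPregroupoid.β x = b)
    (hy : hW.toPregroupoid.α y = a) (hy' : hW.toPregroupoid.β y = b)
    (e : evalElt hW x hx hx' = evalElt hW y hy hy') : x = y :=
  (Arrows.mk_homBetween x hx hx').symm.trans ((congrArg (Arrows.mk a b) e).trans
    (Arrows.mk_homBetween y hy hy'))

lemma evalElt_mk {a : hW.toPregroupoid.A} {b : hW.toPregroupoid.B} (x : evalA hW a ⟶ evalB hW b) :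
    evalElt hW (Arrows.mk a b x) rfl rfl = x :=
  Arrows.homBetween_eq rfl rfl rfl

/-- If `y x⁻¹` and `z w⁻¹` have equal values, then `z` and `y x⁻¹ w` have equal values and so
coincide, which is exactly equivalence of the two pairs. Fractions on the other side are treated
symmetrically. -/
lemma eval_faithful : (eval hW).Faithful where
  map_injective {e e'} f g hfg := by
    cases e <;> cases e'
    · induction f using HFrac.ind with | mk y x h hy hx
      induction g using HFrac.ind with | mk z w h' hz hw
      have e : _ = _ := (evalH_mk hW hy hx rfl h).symm.trans (hfg.trans (evalH_mk hW hz hw rfl h'))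
      refine HFrac.sound (evalElt_injective hW hz rfl
        ((hW.toPregroupoid.α_op _ _ _ _ _).trans hy)
        ((hW.toPregroupoid.β_op _ _ _ _ _).trans h') ?_)
      rw [evalElt_op hW hy rfl hx h hw h', ← Category.assoc, e]
      simp
    · exact Elt.ext (evalElt_injective hW f.hα f.hβ g.hα g.hβ hfg)
    · exact Elt.ext (evalElt_injective hW f.hα f.hβ g.hα g.hβ
        ((IsIso.inv_eq_inv (f := evalElt hW f.val f.hα f.hβ)
          (g := evalElt hW g.val g.hα g.hβ)).1 hfg))
    · induction f using VFrac.ind with | mk x z h hx hz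
      induction g using VFrac.ind with | mk y w h' hy hw
      have e : _ = _ := (evalV_mk hW hx hz rfl h.symm).symm.trans
        (hfg.trans (evalV_mk hW hy hw rfl h'.symm))
      refine VFrac.sound (evalElt_injective hW h'.symm hw
        (hW.toPregroupoid.α_op _ _ _ _ _)
        ((hW.toPregroupoid.β_op _ _ _ _ _).trans hz) ?_)
      rw [evalElt_op hW rfl hy rfl hx h.symm hz, e]
      simp

/-- Surjectivity of `α` supplies an arrow `x` out of `a'` into `B`, and then `k = (k x) x⁻¹`. -/
lemma exists_evalH (a a' : hW.toPregroupoid.A) (k : evalA hW a ⟶ evalA hW a') :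
    ∃ f, evalH hW f = k := by
  obtain ⟨⟨a', b, x⟩, rfl⟩ := hW.α_surjective a'
  refine ⟨HFrac.mk (P := hW.toPregroupoid) (Arrows.mk a b (k ≫ x)) (Arrows.mk a' b x) rfl rfl rfl,
    (evalH_mk hW (b := b) rfl rfl rfl rfl).trans ?_⟩
  exact (congrArg₂ (fun f g => f ≫ inv g) (evalElt_mk hW (k ≫ x)) (evalElt_mk hW x)).trans
    ((IsIso.comp_inv_eq x).2 rfl)

/-- Surjectivity of `β` supplies an arrow `x` from `A` into `b`, and then `k = x⁻¹ (x k)`. -/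
lemma exists_evalV (b b' : hW.toPregroupoid.B) (k : evalB hW b ⟶ evalB hW b') :
    ∃ f, evalV hW f = k := by
  obtain ⟨⟨a, b, x⟩, rfl⟩ := hW.β_surjective b
  refine ⟨VFrac.mk (P := hW.toPregroupoid) (Arrows.mk a b x) (Arrows.mk a b' (x ≫ k)) rfl rfl rfl,
    (evalV_mk hW (a := a) rfl rfl rfl rfl).trans ?_⟩
  exact (congrArg₂ (fun f g => inv f ≫ g) (evalElt_mk hW x) (evalElt_mk hW (x ≫ k))).trans
    ((IsIso.inv_comp_eq x).2 rfl)

lemma exists_evalElt (a : hW.toPregroupoid.A) (b : hW.toPregroupoid.B)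
    (k : evalA hW a ⟶ evalB hW b) :
    ∃ x : hW.toPregroupoid.Elt a b, evalElt hW x.val x.hα x.hβ = k :=
  ⟨⟨Arrows.mk a b k, rfl, rfl⟩, evalElt_mk hW k⟩

lemma eval_full : (eval hW).Full where
  map_surjective {e e'} k := by
    cases e with
    | ofA a =>
      cases e' with
      | ofA a' => exact exists_evalH hW a a' k
      | ofB b => exact exists_evalElt hW a b k
    | ofB b =>
      cases e' with
      | ofA a =>
        change evalB hW b ⟶ evalA hW a at k
        -- Arrows from `B` to `A` are formal inverses, so the element to be found represents the
        -- inverse of `k`.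
        obtain ⟨x, hx⟩ := exists_evalElt hW a b (inv k)
        exact ⟨x, (congrArg (fun k => inv k) hx).trans (IsIso.inv_inv (f := k))⟩
      | ofB b' => exact exists_evalV hW b b' k

end Eval

end Pregroupoid

/-! ### Strict isomorphism of a fibration with the enveloping groupoid of its arrows -/

/-- An equivalence of categories would not suffice: isomorphisms of fibrations need an inverse
functor on the nose. Full faithfulness provides it on arrows, after conjugation with `eqToHom`,
because the inverse on objects is one only propositionally. -/
lemma exists_strict_inverse {C D : Type u} [SmallCategory C] [SmallCategory D] (F : C ⥤ D)
    [F.Full] [F.Faithful] (hF : Function.Bijective F.obj) :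
    ∃ G : D ⥤ C, F ⋙ G = 𝟭 C ∧ G ⋙ F = 𝟭 D := by
  obtain ⟨g, hg₁, hg₂⟩ := Function.bijective_iff_has_inverse.1 hF
  let G : D ⥤ C :=
    { obj := g
      map := fun f => F.preimage (eqToHom (hg₂ _) ≫ f ≫ eqToHom (hg₂ _).symm)
      map_id := fun _ => F.map_injective (by simp)
      map_comp := fun _ _ => F.map_injective (by simp) }
  refine ⟨G, CategoryTheory.Functor.ext hg₁ (fun _ _ f => F.map_injective ?_),
    CategoryTheory.Functor.ext hg₂ (fun _ _ f => ?_)⟩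
  · simp [G, eqToHom_map]
  · simp [G]

lemma map_comp_inv {C D : Type u} [SmallCategory C] [IsGroupoid C] [SmallCategory D]
    (F : C ⥤ D) {a b c : C} (y : a ⟶ b) (x : c ⟶ b) : F.map (y ≫ inv x) = F.map y ≫ inv (F.map x) := by
  simp

lemma map_inv_comp {C D : Type u} [SmallCategory C] [IsGroupoid C] [SmallCategory D]
    (F : C ⥤ D) {a b c : C} (x : a ⟶ b) (z : a ⟶ c) : F.map (inv x ≫ z) = inv (F.map x) ≫ F.map z := by
  simp

lemma basedFunctor_isIso {E F : BasedCategory.{u, u} WalkingIso.{0}} (f : E ⟶ F)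
    [f.toFunctor.Full] [f.toFunctor.Faithful] (hf : Function.Bijective f.toFunctor.obj) :
    IsIso f := by
  obtain ⟨G, h₁, h₂⟩ := exists_strict_inverse f.toFunctor hf
  let g : F ⟶ E :=
    { toFunctor := G
      -- The strict inverse of a functor over the base lies over the base as well.
      w := by rw [← f.w, ← Functor.assoc, h₂]; rfl }
  exact ⟨g, basedFunctor_ext h₁, basedFunctor_ext h₂⟩

namespace GroupoidFibration

/-- The evaluation functor, as a morphism of fibrations. -/
noncomputable def evalBased (E : GroupoidFibration.{u}) :
    (toBitorsor ⋙ Bitorsor.toPregroupoid ⋙ Pregroupoid.env).obj E ⟶ E :=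
  ObjectProperty.homMk
    { toFunctor := Pregroupoid.eval E.bitorsor.property
      w := CategoryTheory.Functor.ext
        (fun e => by
          cases e with
          | ofA a => exact ObjectProperty.FullSubcategory.property a
          | ofB b => exact ObjectProperty.FullSubcategory.property b)
        (fun _ _ _ => rfl) }

/-- The total category splits into the objects over `zero` and those over `one`, each object lying
in exactly one of the two classes. -/
lemma eval_obj_bijective (E : GroupoidFibration.{u}) :
    Function.Bijective (Pregroupoid.evalObj E.bitorsor.property) := by
  constructor
  · rintro (⟨a, ha⟩ | ⟨b, hb⟩) (⟨a', ha'⟩ | ⟨b', hb'⟩) (h : _ = _)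
    · cases h; rfl
    · cases h; cases ha.symm.trans hb'
    · cases h; cases hb.symm.trans ha'
    · cases h; rfl
  · intro x
    generalize h : E.obj.p.obj x = i
    induction i with
    | zero => exact ⟨Pregroupoid.Env.ofA ⟨x, h⟩, rfl⟩
    | one => exact ⟨Pregroupoid.Env.ofB ⟨x, h⟩, rfl⟩

lemma isIso_evalBased (E : GroupoidFibration.{u}) : IsIso E.evalBased := by
  have : E.evalBased.hom.toFunctor.Full :=
    Pregroupoid.eval_full E.bitorsor.property
  have : E.evalBased.hom.toFunctor.Faithful :=
    Pregroupoid.eval_faithful E.bitorsor.property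
  have := basedFunctor_isIso E.evalBased.hom E.eval_obj_bijective
  exact (ObjectProperty.isIso_hom_iff _).1 this

variable {E F : GroupoidFibration.{u}} (f : E ⟶ F)

lemma map_homBetween {x : Arrows E.obj.obj (E.isOver WalkingIso.zero) (E.isOver WalkingIso.one)}
    {a b} (ha : x.dom = a) (hb : x.cod = b) :
    (arrowsMap f x).homBetween (congrArg (overMap f WalkingIso.zero).obj ha)
      (congrArg (overMap f WalkingIso.one).obj hb) =
      f.hom.toFunctor.map (x.homBetween ha hb) := by
  subst ha hb
  refine Arrows.homBetween_eq ?_ rfl rfl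
  simp [Arrows.homBetween, arrowsMap]

lemma map_evalElt {x : E.bitorsor.property.toPregroupoid.X} {a b}
    (ha : E.bitorsor.property.toPregroupoid.α x = a)
    (hb : E.bitorsor.property.toPregroupoid.β x = b) :
    Pregroupoid.evalElt F.bitorsor.property (arrowsMap f x)
      (congrArg (overMap f WalkingIso.zero).obj ha) (congrArg (overMap f WalkingIso.one).obj hb) =
      f.hom.toFunctor.map (Pregroupoid.evalElt E.bitorsor.property x ha hb) :=
  map_homBetween f ha hb

/-- A functor preserves the composites and inverses by which fractions are evaluated, so the square
reduces to the case of a single arrow from `A` to `B`, which is `map_evalElt`. -/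
lemma evalBased_naturality :
    (toBitorsor ⋙ Bitorsor.toPregroupoid ⋙ Pregroupoid.env).map f ≫ F.evalBased =
      E.evalBased ≫ f := by
  refine InducedCategory.hom_ext (basedFunctor_ext (CategoryTheory.Functor.hext ?_ ?_))
  · rintro (a | b) <;> rfl
  · rintro (a | b) (a' | b') k
    · induction k using Pregroupoid.HFrac.ind with | mk y x h hy hx
      exact heq_of_eq ((congrArg₂ (fun f g => f ≫ inv g) (map_evalElt f hy rfl)
        (map_evalElt f hx h)).trans (map_comp_inv f.hom.toFunctor _ _).symm)
    · exact heq_of_eq (map_evalElt f k.hα k.hβ)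
    · exact heq_of_eq ((congrArg (fun g => inv g) (map_evalElt f k.hα k.hβ)).trans
        (Functor.map_inv _ _).symm)
    · induction k using Pregroupoid.VFrac.ind with | mk x z h hx hz
      exact heq_of_eq ((congrArg₂ (fun f g => inv f ≫ g) (map_evalElt f rfl hx)
        (map_evalElt f h.symm hz)).trans (map_inv_comp f.hom.toFunctor _ _).symm)

/-- Every fibration-in-groupoids is naturally isomorphic to the enveloping groupoid of its
pregroupoid of arrows. -/
noncomputable def evalIso :
    toBitorsor ⋙ Bitorsor.toPregroupoid ⋙ Pregroupoid.env ≅ 𝟭 GroupoidFibration.{u} :=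
  NatIso.ofComponents (fun E => @asIso _ _ _ _ E.evalBased E.isIso_evalBased)
    evalBased_naturality

end GroupoidFibration

/-- The bitorsor of arrows from `A` to `B` in the enveloping groupoid of a bitorsor. -/
noncomputable def Bitorsor.envIso :
    (Bitorsor.toPregroupoid ⋙ Pregroupoid.env) ⋙ GroupoidFibration.toBitorsor ≅
      𝟭 Bitorsor.{u} :=
  -- The required isomorphism exists after applying `Bitorsor.toPregroupoid`, as `arrowsIso` at the
  -- pregroupoid of the bitorsor; full faithfulness lifts it.
  Functor.fullyFaithfulCancelRight Bitorsor.toPregroupoid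
    (Functor.isoWhiskerLeft Bitorsor.toPregroupoid Pregroupoid.arrowsIso.symm)

end Kock

theorem theorem4p1 :
    (∃ e : Kock.GroupoidFibration.{u} ≌ Kock.Bitorsor.{u},
      e.functor = Kock.GroupoidFibration.toBitorsor ∧
      e.inverse = Kock.Bitorsor.toPregroupoid ⋙ Kock.Pregroupoid.env) ∧
    (∃ e : Kock.GroupoidFibration.{u} ≌ Kock.Pregroupoid.{u},
      e.functor = Kock.GroupoidFibration.toBitorsor ⋙ Kock.Bitorsor.toPregroupoid ∧
      e.inverse = Kock.Pregroupoid.env) :=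
  -- The triangle identity is obtained by adjusting the unit alone, so both functors remain the
  -- prescribed ones. The isomorphism `evalIso` serves both equivalences, since their round trips on
  -- fibrations coincide.
  ⟨⟨.mk _ _ Kock.GroupoidFibration.evalIso.symm Kock.Bitorsor.envIso, rfl, rfl⟩,
    ⟨.mk (Kock.GroupoidFibration.toBitorsor ⋙ Kock.Bitorsor.toPregroupoid) Kock.Pregroupoid.env
      Kock.GroupoidFibration.evalIso.symm Kock.Pregroupoid.arrowsIso.symm, rfl, rfl⟩⟩
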